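/- Let $n\ge 1$ and write $|\cdot|$ for Lebesgue measure. For a set $K\subset\mathbb{R}^n$ that is compact and convex, or an open ball, let $h_{\Pi K}$ be the positively homogeneous function on $\mathbb{R}^n$ with $h_{\Pi K}(u)=|P_{u^\perp}K|$ for unit vectors $u$, where $P_{u^\perp}$ is the orthogonal projection onto $u^\perp$ and $|P_{u^\perp}K|$ is the $(n-1)$-dimensional volume in $u^\perp$ (for $n=1$ it is the counting measure of the one-point space $u^\perp$), and let $\Pi^\circ K=\{x\in\mathbb{R}^n : h_{\Pi K}(x)\le 1\}$ be the polar projection body. For a set $A\subset\mathbb{R}^n$ of finite volume let $A^*$ be the open Euclidean ball centred at the origin with $|A^*|=|A|$, and for an integrable $f:\mathbb{R}^n\to[0,\infty)$ let $f^*(x)=\int_0^\infty \mathbf 1_{\{f>t\}^*}(x)\,dt$ be its symmetric decreasing rearrangement. For an $n\times m$ matrix $X$ with columns $X_1,\dots,X_m$ and $C\subset\mathbb{R}^m$ let $XC=\{\sum_j c_jX_j : c\in C\}$. **Theorem.** (a) Let $C\subset\mathbb{R}^m$ be a compact convex set, let $f$ be a probability density on $\mathbb{R}^n$, and let $X$ and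 $X^{\#}$ be $n\times m$ random matrices with independent columns distributed according to the densities $f$ and $f^*$, respectively. Then for every radial measure $\nu$ on $\mathbb{R}^n$ with decreasing density, i.e. $d\nu(x)=\rho(|x|)\,dx$ with $\rho\ge 0$ non-increasing on $(0,\infty)$, $$\mathbb{E}\,\nu\bigl(\Pi^\circ(XC)\bigr)\le \mathbb{E}\,\nu\bigl(\Pi^\circ(X^{\#}C)\bigr),$$ as an inequality in $[0,\infty]$. (b) In particular, let $K\subset\mathbb{R}^n$ be a convex body (compact, convex, with non-empty interior), and let $[K]_m$ and $[K^*]_m$ be the convex hulls of $m$ independent random points distributed uniformly in $K$ and in $K^*$, respectively. Then $$\mathbb{E}\,|\Pi^\circ([K]_m)|\le \mathbb{E}\,|\Pi^\circ([K^*]_m)|.$$ (c) Consequently, Petty's projection inequality holds: $|\Pi^\circ(K)|\le|\Pi^\circ(K^*)|$ for every convex body $K\subset\mathbb{R}^n$. -/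

import Mathlib

open MeasureTheory ProbabilityTheory Set
open scoped ENNReal

noncomputable section

/-- Lebesgue measure of the linear subspace `S` of `ℝⁿ`, normalised by the inner product inherited
from `ℝⁿ`: the parallelepiped spanned by an orthonormal basis of `S` has measure `1`.
The instance is named so as not to confuse it with the restriction to `S` of the ambient Lebesgue
measure, which vanishes on proper subspaces. -/
def subspaceVolume {n : ℕ} (S : Submodule ℝ (EuclideanSpace ℝ (Fin n))) : Measure S :=
  (measureSpaceOfInnerProductSpace (E := S)).volume

/-- Support function of the projection body: `h_{ΠK}(u) = |P_{u^⊥} K|` (the `(n-1)`-dimensional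
volume) for unit vectors `u`, extended to all of `ℝⁿ` by positive homogeneity.
Here `(ℝ ∙ x)ᗮ = x^⊥` depends only on the direction of `x`. -/
def projectionBodySupport {n : ℕ} (K : Set (EuclideanSpace ℝ (Fin n)))
    (x : EuclideanSpace ℝ (Fin n)) : ℝ≥0∞ :=
  ENNReal.ofReal ‖x‖ *
    subspaceVolume (Submodule.span ℝ {x})ᗮ
      ((Submodule.span ℝ {x})ᗮ.orthogonalProjectionOnto '' K)

/-- The polar projection body `Π°K = (ΠK)° = {x : h_{ΠK}(x) ≤ 1}`. -/
def polarProjectionBody {n : ℕ} (K : Set (EuclideanSpace ℝ (Fin n))) :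
    Set (EuclideanSpace ℝ (Fin n)) :=
  {x | projectionBodySupport K x ≤ 1}

/-- The set `[x₁ … x_m] C = {∑ⱼ cⱼ xⱼ : c ∈ C}`, the image of `C ⊆ ℝᵐ` under the `n × m` matrix
whose columns are `x₁, …, x_m ∈ ℝⁿ`. -/
def matrixImage {n m : ℕ} (x : Fin m → EuclideanSpace ℝ (Fin n))
    (C : Set (EuclideanSpace ℝ (Fin m))) : Set (EuclideanSpace ℝ (Fin n)) :=
  (fun c : EuclideanSpace ℝ (Fin m) => ∑ j, c j • x j) '' C

/-- The symmetric rearrangement `A^*` of a set `A ⊆ ℝⁿ` of finite volume (`n ≥ 1`): the open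
Euclidean ball centred at the origin with the same volume as `A`. -/
def symmRearrangement {n : ℕ} (A : Set (EuclideanSpace ℝ (Fin n))) :
    Set (EuclideanSpace ℝ (Fin n)) :=
  Metric.ball 0
    ((volume.real A / volume.real (Metric.ball (0 : EuclideanSpace ℝ (Fin n)) 1)) ^
      (1 / (n : ℝ)))

/-- The rearranged set has the same volume. -/
theorem volume_symmRearrangement {n : ℕ} (hn : 1 ≤ n) (A : Set (EuclideanSpace ℝ (Fin n)))
    (hA : volume A ≠ ∞) : volume (symmRearrangement A) = volume A := by
  have hn0 : n ≠ 0 := by omega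
  have : Nonempty (Fin n) := ⟨⟨0, hn⟩⟩
  have hB0 : volume (Metric.ball (0 : EuclideanSpace ℝ (Fin n)) 1) ≠ 0 :=
    (Metric.measure_ball_pos _ _ one_pos).ne'
  have hB : volume (Metric.ball (0 : EuclideanSpace ℝ (Fin n)) 1) ≠ ∞ := measure_ball_lt_top.ne
  have hBr : 0 < volume.real (Metric.ball (0 : EuclideanSpace ℝ (Fin n)) 1) :=
    ENNReal.toReal_pos hB0 hB
  have hq : 0 ≤ volume.real A / volume.real (Metric.ball (0 : EuclideanSpace ℝ (Fin n)) 1) := by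
    positivity
  rw [symmRearrangement, Measure.addHaar_ball _ _ (by positivity)]
  rw [finrank_euclideanSpace_fin, one_div, Real.rpow_inv_natCast_pow hq hn0,
    ← ENNReal.ofReal_toReal hB, ← ENNReal.ofReal_mul hq]
  change ENNReal.ofReal (_ / volume.real _ * volume.real _) = _
  rw [div_mul_cancel₀ _ hBr.ne']
  exact ENNReal.ofReal_toReal hA

/-- The symmetric decreasing rearrangement `f^*(x) = ∫₀^∞ 1[x ∈ {f > t}^*] dt` of an integrable
`f : ℝⁿ → [0,∞)`. The value is in `[0,∞]`, since `f^*(0)` is infinite for unbounded `f`. -/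
def symmDecrRearrangement {n : ℕ} (f : EuclideanSpace ℝ (Fin n) → ℝ)
    (x : EuclideanSpace ℝ (Fin n)) : ℝ≥0∞ :=
  ∫⁻ t in Ioi (0 : ℝ), (symmRearrangement {y | t < f y}).indicator (fun _ => 1) x

/-- `f` is the density of a probability distribution on `ℝⁿ`. -/
structure IsProbDensity {n : ℕ} (f : EuclideanSpace ℝ (Fin n) → ℝ) : Prop where
  nonneg : ∀ x, 0 ≤ f x
  integrable : Integrable f volume
  integral_eq_one : ∫ x, f x = 1

/-- `X₁, …, X_m` are independent random vectors in `ℝⁿ`, each with density `g`; equivalently, the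
random `n × m` matrix with columns `X₁, …, X_m` has i.i.d. columns of density `g`. -/
structure HasIIDColumns {n m : ℕ} {Ω : Type*} [MeasurableSpace Ω] (P : Measure Ω)
    (X : Fin m → Ω → EuclideanSpace ℝ (Fin n)) (g : EuclideanSpace ℝ (Fin n) → ℝ≥0∞) : Prop where
  measurable : ∀ j, Measurable (X j)
  indep : iIndepFun X P
  law : ∀ j, P.map (X j) = volume.withDensity g

/-- `Y₁, …, Y_m` are independent random vectors, each uniformly distributed in `K`. -/
structure IsUniformSample {n m : ℕ} {Ω : Type*} [MeasurableSpace Ω] (P : Measure Ω)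
    (Y : Fin m → Ω → EuclideanSpace ℝ (Fin n)) (K : Set (EuclideanSpace ℝ (Fin n))) : Prop where
  measurable : ∀ j, Measurable (Y j)
  indep : iIndepFun Y P
  uniform : ∀ j, pdf.IsUniform (Y j) K P volume

/-- `ν` is a radial measure with a decreasing density: `dν(x) = ρ(|x|) dx` with `ρ ≥ 0`
decreasing (in the weak sense). The value `ρ(0)` does not matter. -/
def IsRadialDecreasing {n : ℕ} (ν : Measure (EuclideanSpace ℝ (Fin n))) : Prop :=
  ∃ ρ : ℝ → ℝ, AntitoneOn ρ (Ioi 0) ∧ (∀ r, 0 < r → 0 ≤ ρ r) ∧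
    ν = volume.withDensity (fun x => ENNReal.ofReal (ρ ‖x‖))

/-- A convex body in `ℝⁿ`: a compact convex set with non-empty interior. -/
structure IsConvexBody {n : ℕ} (K : Set (EuclideanSpace ℝ (Fin n))) : Prop where
  convex : Convex ℝ K
  compact : IsCompact K
  interior_nonempty : (interior K).Nonempty

end

/-!
The volume `|K + [0, N] u| = |K| + N h_{ΠK}(u)` of a sweep of `K` along `u` is the volume of a
linear image of a fixed convex set, hence convex when all the columns `u, x₁, …, x_m` move at
constant velocity in one direction `θ` (a shadow system). Letting `N → ∞`, so is `h_{ΠK}(u)`;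
reflecting in `θ^⊥`, the set of `(u, x₁, …, x_m)` with `u ∈ Π°([x₁ … x_m] C)` has convex
symmetric sections with respect to simultaneous motion of all its points along `θ`. For such a set
the Brascamp–Lieb–Luttinger argument applies: in one dimension, sliding intervals to the origin
does not decrease the measure of the section (Prékopa–Leindler), so each Steiner symmetrization of
the densities increases the measure of the set, and iterated Steiner symmetrizations converge to
the symmetric decreasing rearrangement. With the indicator of a ball as density for `u` this
compares `ν (Π°)` for the restrictions `ν` of Lebesgue measure to balls, hence for all radially
decreasing `ν`. Uniform points and the standard simplex `C` give random polytopes, which exhaust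
the body as `m → ∞`; this yields Petty's inequality.
-/

theorem volume_setOf_ofReal_lt_inter_Ioi (c : ℝ≥0∞) :
    volume ({t : ℝ | ENNReal.ofReal t < c} ∩ Ioi 0) = c := by
  rcases eq_or_ne c ∞ with rfl | hc
  · simp
  have : {t : ℝ | ENNReal.ofReal t < c} ∩ Ioi 0 = Ioo 0 c.toReal := by
    ext t
    rw [mem_inter_iff, and_comm]
    exact and_congr_right fun ht => ENNReal.ofReal_lt_iff_lt_toReal (le_of_lt ht) hc
  rw [this, Real.volume_Ioo, sub_zero, ENNReal.ofReal_toReal hc]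

theorem lintegral_eq_lintegral_meas_ofReal_lt {α : Type*} [MeasurableSpace α]
    (μ : Measure α) [SFinite μ] {F : α → ℝ≥0∞} (hF : Measurable F) :
    ∫⁻ x, F x ∂μ = ∫⁻ t in Ioi (0 : ℝ), μ {x | ENNReal.ofReal t < F x} := by
  set D : Set (α × ℝ) := {p | ENNReal.ofReal p.2 < F p.1}
  have hD : MeasurableSet D :=
    measurableSet_lt (ENNReal.measurable_ofReal.comp measurable_snd) (hF.comp measurable_fst)
  calc ∫⁻ x, F x ∂μ
      = ∫⁻ x, volume.restrict (Ioi 0) {t : ℝ | ENNReal.ofReal t < F x} ∂μ := by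
        refine lintegral_congr fun x => ?_
        rw [Measure.restrict_apply' measurableSet_Ioi, volume_setOf_ofReal_lt_inter_Ioi]
    _ = (μ.prod (volume.restrict (Ioi 0))) D := (Measure.prod_apply hD).symm
    _ = ∫⁻ t in Ioi (0 : ℝ), μ {x | ENNReal.ofReal t < F x} := Measure.prod_apply_symm hD

theorem volume_image_mul_add_const (A : Set ℝ) {a : ℝ} (ha : 0 ≤ a) (b : ℝ) :
    volume ((fun x => a * x + b) '' A) = ENNReal.ofReal a * volume A := by
  rw [← image_image (· + b) (a * ·), image_add_right, measure_preimage_add_right]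
  exact (Measure.addHaar_smul volume a A).trans (by simp [abs_of_nonneg ha])

theorem weighted_add_volume_le_of_isCompact {A B C : Set ℝ} (hA : IsCompact A) (hB : IsCompact B)
    (hA0 : A.Nonempty) (hB0 : B.Nonempty) {a b : ℝ} (ha : 0 ≤ a) (hb : 0 ≤ b)
    (hC : ∀ x ∈ A, ∀ y ∈ B, a * x + b * y ∈ C) :
    ENNReal.ofReal a * volume A + ENNReal.ofReal b * volume B ≤ volume C := by
  obtain ⟨p, hpA, hp⟩ := hA.exists_isMaxOn hA0 continuousOn_id
  obtain ⟨q, hqB, hq⟩ := hB.exists_isMinOn hB0 continuousOn_id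
  -- With `p = max A` and `q = min B`, the sets `a • A + b * q` and `a * p + b • B` only meet at
  -- `a * p + b * q`.
  rw [← volume_image_mul_add_const A ha (b * q), ← volume_image_mul_add_const B hb (a * p),
    ← measure_union₀' (hA.image (by fun_prop)).measurableSet.nullMeasurableSet]
  · refine measure_mono ?_
    rintro _ (⟨x, hx, rfl⟩ | ⟨y, hy, rfl⟩)
    · exact hC x hx q hqB
    · simpa only [add_comm] using hC p hpA y hy
  · refine measure_mono_null (t := {a * p + b * q}) ?_ (by simp)
    rintro _ ⟨⟨x, hx, rfl⟩, ⟨y, hy, hxy⟩⟩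
    have hx' : a * x ≤ a * p := mul_le_mul_of_nonneg_left (hp hx) ha
    have hy' : b * q ≤ b * y := mul_le_mul_of_nonneg_left (hq hy) hb
    simp only at hxy
    rw [mem_singleton_iff]
    linarith

theorem weighted_add_volume_le {A B C : Set ℝ} (hA : MeasurableSet A)
    (hB : MeasurableSet B) (hA0 : A.Nonempty) (hB0 : B.Nonempty) {a b : ℝ} (ha : 0 ≤ a)
    (hb : 0 ≤ b) (hC : ∀ x ∈ A, ∀ y ∈ B, a * x + b * y ∈ C) :
    ENNReal.ofReal a * volume A + ENNReal.ofReal b * volume B ≤ volume C := by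
  obtain ⟨x₀, hx₀⟩ := hA0
  obtain ⟨y₀, hy₀⟩ := hB0
  rw [hA.measure_eq_iSup_isCompact, hB.measure_eq_iSup_isCompact]
  simp_rw [ENNReal.mul_iSup, iSup_and']
  refine ENNReal.biSup_add_biSup_le' ⟨∅, empty_subset _, isCompact_empty⟩
    ⟨∅, empty_subset _, isCompact_empty⟩ ?_
  rintro K ⟨hKA, hK⟩ L ⟨hLB, hL⟩
  calc ENNReal.ofReal a * volume K + ENNReal.ofReal b * volume L
      ≤ ENNReal.ofReal a * volume (insert x₀ K) + ENNReal.ofReal b * volume (insert y₀ L) := by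
        gcongr <;> exact subset_insert _ _
    _ ≤ volume C := weighted_add_volume_le_of_isCompact (hK.insert x₀) (hL.insert y₀)
        (insert_nonempty _ _) (insert_nonempty _ _) ha hb fun x hx y hy =>
          hC x (insert_subset hx₀ hKA hx) y (insert_subset hy₀ hLB hy)

theorem rpow_mul_rpow_le_weighted_add {a b : ℝ} (ha : 0 < a) (hb : 0 < b) (hab : a + b = 1)
    (u v : ℝ≥0∞) : u ^ a * v ^ b ≤ ENNReal.ofReal a * u + ENNReal.ofReal b * v := by
  have young := ENNReal.young_inequality (u ^ a) (v ^ b) (Real.HolderConjugate.inv_inv ha hb hab)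
  rwa [ENNReal.rpow_rpow_inv ha.ne', ENNReal.rpow_rpow_inv hb.ne',
    ENNReal.ofReal_inv_of_pos ha, ENNReal.ofReal_inv_of_pos hb, div_eq_mul_inv, div_eq_mul_inv,
    inv_inv, inv_inv, mul_comm u, mul_comm v] at young

section PrekopaLeindlerReal

variable {f g h : ℝ → ℝ≥0∞} {a b : ℝ}

theorem weighted_add_volume_superlevel_le (hf : Measurable f) (hg : Measurable g) (ha : 0 < a)
    (hb : 0 < b) (hab : a + b = 1) (hle : ∀ x y, f x ^ a * g y ^ b ≤ h (a * x + b * y))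
    {t : ℝ≥0∞} (ht0 : t ≠ 0) (htf : t < ⨆ x, f x) (htg : t < ⨆ x, g x) :
    ENNReal.ofReal a * volume {x | t < f x} + ENNReal.ofReal b * volume {x | t < g x} ≤
      volume {x | t < h x} := by
  refine weighted_add_volume_le (measurableSet_lt measurable_const hf)
    (measurableSet_lt measurable_const hg) (lt_iSup_iff.1 htf) (lt_iSup_iff.1 htg) ha.le hb.le
    fun x hx y hy => ?_
  calc t = t ^ a * t ^ b := by rw [← ENNReal.rpow_add _ _ ht0 htf.ne_top, hab, ENNReal.rpow_one]
    _ < f x ^ a * g y ^ b :=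
      ENNReal.mul_lt_mul (ENNReal.rpow_lt_rpow hx ha) (ENNReal.rpow_lt_rpow hy hb)
    _ ≤ h (a * x + b * y) := hle x y

theorem weighted_add_lintegral_min_one_le (hf : Measurable f) (hg : Measurable g)
    (hh : Measurable h) (ha : 0 < a) (hb : 0 < b) (hab : a + b = 1)
    (hle : ∀ x y, f x ^ a * g y ^ b ≤ h (a * x + b * y))
    (hf1 : 1 ≤ ⨆ x, f x) (hg1 : 1 ≤ ⨆ x, g x) :
    ENNReal.ofReal a * (∫⁻ x, min (f x) 1) + ENNReal.ofReal b * (∫⁻ x, min (g x) 1) ≤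
      ∫⁻ x, h x := by
  have hmeas : Measurable fun t : ℝ => volume {x | ENNReal.ofReal t < min (f x) 1} :=
    measurable_measure_prodMk_left (measurableSet_lt (ENNReal.measurable_ofReal.comp measurable_fst)
      ((hf.min measurable_const).comp measurable_snd))
  rw [lintegral_eq_lintegral_meas_ofReal_lt _ hh,
    lintegral_eq_lintegral_meas_ofReal_lt _ (hf.min measurable_const),
    lintegral_eq_lintegral_meas_ofReal_lt _ (hg.min measurable_const),
    ← lintegral_const_mul' _ _ ENNReal.ofReal_ne_top,
    ← lintegral_const_mul' _ _ ENNReal.ofReal_ne_top, ← lintegral_add_left (hmeas.const_mul _)]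
  refine setLIntegral_mono' measurableSet_Ioi fun t ht => ?_
  by_cases ht1 : ENNReal.ofReal t < 1
  · simpa only [lt_min_iff, ht1, and_true] using weighted_add_volume_superlevel_le hf hg ha hb hab
      hle (ENNReal.ofReal_pos.2 ht).ne' (ht1.trans_le hf1) (ht1.trans_le hg1)
  · simp [ht1]

theorem lintegral_min_rpow_mul_le (hf : Measurable f) (hg : Measurable g) (hh : Measurable h)
    (ha : 0 < a) (hb : 0 < b) (hab : a + b = 1)
    (hle : ∀ x y, f x ^ a * g y ^ b ≤ h (a * x + b * y)) {α β : ℝ≥0∞} (hα0 : α ≠ 0) (hα : α ≠ ∞)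
    (hβ0 : β ≠ 0) (hβ : β ≠ ∞) (hαf : α ≤ ⨆ x, f x) (hβg : β ≤ ⨆ x, g x) :
    (∫⁻ x, min (f x) α) ^ a * (∫⁻ x, min (g x) β) ^ b ≤ ∫⁻ x, h x := by
  have hM0 : α ^ a * β ^ b ≠ 0 := by simp [hα0, hβ0, hα, hβ]
  have hM : α ^ a * β ^ b ≠ ∞ := ENNReal.mul_ne_top (ENNReal.rpow_ne_top_of_nonneg ha.le hα)
    (ENNReal.rpow_ne_top_of_nonneg hb.le hβ)
  have hmin (k : ℝ → ℝ≥0∞) {γ : ℝ≥0∞} (h0 : γ ≠ 0) (ht : γ ≠ ∞) :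
      ∫⁻ x, min (k x) γ = γ * ∫⁻ x, min (γ⁻¹ * k x) 1 := by
    rw [← lintegral_const_mul' _ _ ht]
    refine lintegral_congr fun x => ?_
    rw [mul_min, ← mul_assoc, ENNReal.mul_inv_cancel h0 ht, one_mul, mul_one]
  have hsup (k : ℝ → ℝ≥0∞) {γ : ℝ≥0∞} (h0 : γ ≠ 0) (ht : γ ≠ ∞) (hk : γ ≤ ⨆ x, k x) :
      1 ≤ ⨆ x, γ⁻¹ * k x := by
    rw [← ENNReal.mul_iSup, ← ENNReal.inv_mul_cancel h0 ht]
    gcongr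
  have scaled := weighted_add_lintegral_min_one_le (h := fun x => (α ^ a * β ^ b)⁻¹ * h x)
    (hf.const_mul α⁻¹) (hg.const_mul β⁻¹) (hh.const_mul _) ha hb hab (fun x y => ?_)
    (hsup f hα0 hα hαf) (hsup g hβ0 hβ hβg)
  · calc (∫⁻ x, min (f x) α) ^ a * (∫⁻ x, min (g x) β) ^ b
        = α ^ a * β ^ b * ((∫⁻ x, min (α⁻¹ * f x) 1) ^ a * (∫⁻ x, min (β⁻¹ * g x) 1) ^ b) := by
          rw [hmin f hα0 hα, hmin g hβ0 hβ, ENNReal.mul_rpow_of_nonneg _ _ ha.le,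
            ENNReal.mul_rpow_of_nonneg _ _ hb.le, mul_mul_mul_comm]
      _ ≤ α ^ a * β ^ b * ∫⁻ x, (α ^ a * β ^ b)⁻¹ * h x := by
          gcongr
          exact (rpow_mul_rpow_le_weighted_add ha hb hab _ _).trans scaled
      _ = ∫⁻ x, h x := by
          rw [lintegral_const_mul _ hh, ← mul_assoc, ENNReal.mul_inv_cancel hM0 hM, one_mul]
  · rw [ENNReal.mul_rpow_of_nonneg _ _ ha.le, ENNReal.mul_rpow_of_nonneg _ _ hb.le,
      mul_mul_mul_comm, ENNReal.inv_rpow, ENNReal.inv_rpow,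
      ← ENNReal.mul_inv (Or.inl (by simp [hα0, hα]))
        (Or.inl (ENNReal.rpow_ne_top_of_nonneg ha.le hα))]
    gcongr
    exact hle x y

theorem iSup_lintegral_min_natCast {α : Type*} [MeasurableSpace α] (μ : Measure α)
    {k : α → ℝ≥0∞} (hk : Measurable k) : ⨆ n : ℕ, ∫⁻ x, min (k x) (n + 1) ∂μ = ∫⁻ x, k x ∂μ := by
  have htop : ⨆ n : ℕ, ((n : ℝ≥0∞) + 1) = ∞ := by
    rw [← ENNReal.iSup_add, ENNReal.iSup_natCast, top_add]
  rw [← lintegral_iSup (fun n => hk.min measurable_const)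
    fun n m hnm x => by dsimp only; gcongr]
  refine lintegral_congr fun x => ?_
  rw [← inf_iSup_eq, htop, inf_top_eq]

theorem prekopa_leindler_real (hf : Measurable f) (hg : Measurable g) (hh : Measurable h)
    (ha : 0 < a) (hb : 0 < b) (hab : a + b = 1)
    (hle : ∀ x y, f x ^ a * g y ^ b ≤ h (a * x + b * y)) :
    (∫⁻ x, f x) ^ a * (∫⁻ x, g x) ^ b ≤ ∫⁻ x, h x := by
  by_cases hf0 : ⨆ x, f x = 0
  · have : ∀ x, f x = 0 := by simpa using hf0
    simp [this, ha]
  by_cases hg0 : ⨆ x, g x = 0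
  · have : ∀ x, g x = 0 := by simpa using hg0
    simp [this, hb]
  have truncate (k : ℝ → ℝ≥0∞) (n : ℕ) :
      ∫⁻ x, min (k x) (n + 1) = ∫⁻ x, min (k x) (min (⨆ x, k x) (n + 1)) :=
    lintegral_congr fun x => by rw [← min_assoc, min_eq_left (le_iSup k x)]
  have hlim {k : ℝ → ℝ≥0∞} (hk : Measurable k) {c : ℝ} (hc : 0 < c) :
      (∫⁻ x, k x) ^ c = ⨆ n : ℕ, (∫⁻ x, min (k x) (n + 1)) ^ c := by
    rw [← iSup_lintegral_min_natCast volume hk]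
    exact (ENNReal.orderIsoRpow c hc).map_iSup _
  rw [hlim hf ha, hlim hg hb]
  simp_rw [ENNReal.iSup_mul, ENNReal.mul_iSup]
  refine iSup_le fun n => iSup_le fun m => ?_
  rw [truncate f, truncate g]
  exact lintegral_min_rpow_mul_le hf hg hh ha hb hab hle
    (lt_min (pos_iff_ne_zero.2 hf0) (by positivity)).ne' (by simp)
    (lt_min (pos_iff_ne_zero.2 hg0) (by positivity)).ne' (by simp) (min_le_left _ _)
    (min_le_left _ _)

end PrekopaLeindlerReal

section FinCons

variable {α : Type*} [MeasurableSpace α] {k : ℕ}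

theorem measurePreserving_finCons (μ : Fin (k + 1) → Measure α) [∀ i, SigmaFinite (μ i)] :
    MeasurePreserving (fun p : α × (Fin k → α) => (Fin.cons p.1 p.2 : Fin (k + 1) → α))
      ((μ 0).prod (Measure.pi fun i => μ i.succ)) (Measure.pi μ) := by
  convert! (measurePreserving_piFinSuccAbove μ 0).symm using 1
  ext p i
  refine Fin.cases ?_ (fun i => ?_) i <;> simp [MeasurableEquiv.piFinSuccAbove]

theorem measurable_finCons :
    Measurable fun p : α × (Fin k → α) => (Fin.cons p.1 p.2 : Fin (k + 1) → α) :=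
  (measurePreserving_finCons fun _ => (0 : Measure α)).measurable

theorem lintegral_pi_finCons (μ : Fin (k + 1) → Measure α) [∀ i, SigmaFinite (μ i)]
    {F : (Fin (k + 1) → α) → ℝ≥0∞} (hF : Measurable F) :
    ∫⁻ x, F x ∂Measure.pi μ =
      ∫⁻ t, ∫⁻ y, F (Fin.cons t y) ∂(Measure.pi fun i => μ i.succ) ∂μ 0 := by
  rw [← (measurePreserving_finCons μ).lintegral_comp hF]
  exact lintegral_prod _ (hF.comp measurable_finCons).aemeasurable

end FinCons

theorem prekopa_leindler_fin {k : ℕ} {f g h : (Fin k → ℝ) → ℝ≥0∞} (hf : Measurable f)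
    (hg : Measurable g) (hh : Measurable h) {a b : ℝ} (ha : 0 < a) (hb : 0 < b)
    (hab : a + b = 1) (hle : ∀ x y, f x ^ a * g y ^ b ≤ h (a • x + b • y)) :
    (∫⁻ x, f x) ^ a * (∫⁻ x, g x) ^ b ≤ ∫⁻ x, h x := by
  induction k with
  | zero =>
    have : (volume : Measure (Fin 0 → ℝ)) univ = 1 := by simp [volume_pi]
    simp only [lintegral_unique, this, mul_one]
    exact (hle _ _).trans_eq (congrArg h (Subsingleton.elim _ _))
  | succ k ih =>
    have slice {F : (Fin (k + 1) → ℝ) → ℝ≥0∞} (hF : Measurable F) (t : ℝ) :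
        Measurable fun y : Fin k → ℝ => F (Fin.cons t y) :=
      hF.comp (measurable_finCons.comp measurable_prodMk_left)
    have marginal {F : (Fin (k + 1) → ℝ) → ℝ≥0∞} (hF : Measurable F) :
        Measurable fun t : ℝ => ∫⁻ y : Fin k → ℝ, F (Fin.cons t y) :=
      (hF.comp measurable_finCons).lintegral_prod_right'
    simp only [volume_pi, lintegral_pi_finCons _ hf, lintegral_pi_finCons _ hg,
      lintegral_pi_finCons _ hh]
    refine prekopa_leindler_real (marginal hf) (marginal hg) (marginal hh) ha hb hab fun s t =>
      ih (slice hf s) (slice hg t) (slice hh _) fun x y => (hle _ _).trans_eq ?_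
    congr 1
    ext i
    refine Fin.cases ?_ (fun i => ?_) i <;> simp

theorem prekopa_leindler {ι : Type*} [Fintype ι] {f g h : (ι → ℝ) → ℝ≥0∞} (hf : Measurable f)
    (hg : Measurable g) (hh : Measurable h) {a b : ℝ} (ha : 0 < a) (hb : 0 < b)
    (hab : a + b = 1) (hle : ∀ x y, f x ^ a * g y ^ b ≤ h (a • x + b • y)) :
    (∫⁻ x, f x) ^ a * (∫⁻ x, g x) ^ b ≤ ∫⁻ x, h x := by
  have he := volume_measurePreserving_piCongrLeft (fun _ : ι => ℝ) (Fintype.equivFin ι).symm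
  rw [← he.lintegral_comp hf, ← he.lintegral_comp hg, ← he.lintegral_comp hh]
  refine prekopa_leindler_fin (hf.comp he.measurable) (hg.comp he.measurable)
    (hh.comp he.measurable) ha hb hab fun x y => (hle _ _).trans_eq (congrArg h ?_)
  ext i
  simp [MeasurableEquiv.piCongrLeft, Equiv.piCongrLeft, Equiv.piCongrLeft']

theorem indicator_rpow_mul_indicator_rpow_le {α : Type*} {A B C : Set α} {x y z : α} {a b : ℝ}
    (ha : 0 < a) (hb : 0 < b) (h : x ∈ A → y ∈ B → z ∈ C) :
    A.indicator (1 : α → ℝ≥0∞) x ^ a * B.indicator (1 : α → ℝ≥0∞) y ^ b ≤ C.indicator 1 z := by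
  by_cases hx : x ∈ A <;> by_cases hy : y ∈ B <;>
    simp [hx, hy, ENNReal.zero_rpow_of_pos, ha, hb, h]

section SymmetricConvex

variable {ι : Type*} [Fintype ι] {M : Set (ι → ℝ)} (hM : MeasurableSet M) (hMc : Convex ℝ M)
  (hMs : ∀ x ∈ M, -x ∈ M)

include hM hMc hMs

/-- **Anderson's theorem**, in the form that sliding `Q` towards the origin increases the measure
of its intersection with `M`. -/
theorem volume_inter_translate_le {Q : Set (ι → ℝ)} (hQ : MeasurableSet Q) (hQc : Convex ℝ Q)
    (hQs : ∀ x ∈ Q, -x ∈ Q) (v : ι → ℝ) {τ : ℝ} (h0 : 0 ≤ τ) (h1 : τ ≤ 1) :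
    volume (M ∩ (· - v) ⁻¹' Q) ≤ volume (M ∩ (· - τ • v) ⁻¹' Q) := by
  rcases h1.eq_or_lt with rfl | h1
  · simp
  have hm (w : ι → ℝ) : MeasurableSet (M ∩ (· - w) ⁻¹' Q) :=
    hM.inter (hQ.preimage (measurable_id.sub_const w))
  have hneg : volume (M ∩ (· - -v) ⁻¹' Q) = volume (M ∩ (· - v) ⁻¹' Q) := by
    rw [← Measure.measure_neg (μ := volume) (M ∩ (· - v) ⁻¹' Q)]
    congr 1
    ext x
    have hM' : x ∈ M ↔ -x ∈ M := ⟨hMs x, fun h => by simpa using hMs _ h⟩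
    have hQ' : x - -v ∈ Q ↔ -x - v ∈ Q :=
      ⟨fun h => by convert! hQs _ h using 1; ring, fun h => by convert! hQs _ h using 1; ring⟩
    exact and_congr hM' hQ'
  have ha : 0 < (1 + τ) / 2 := by linarith
  have hb : 0 < (1 - τ) / 2 := by linarith
  have hab : (1 + τ) / 2 + (1 - τ) / 2 = 1 := by ring
  have hpl := prekopa_leindler (measurable_one.indicator (hm v))
    (measurable_one.indicator (hm (-v))) (measurable_one.indicator (hm (τ • v))) ha hb hab
    fun x y => indicator_rpow_mul_indicator_rpow_le ha hb fun hx hy =>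
      ⟨hMc hx.1 hy.1 ha.le hb.le hab, by
        rw [mem_preimage]
        convert! hQc hx.2 hy.2 ha.le hb.le hab using 1
        module⟩
  rwa [lintegral_indicator_one (hm _), lintegral_indicator_one (hm _),
    lintegral_indicator_one (hm _), hneg, ← ENNReal.rpow_add_of_nonneg _ _ ha.le hb.le, hab,
    ENNReal.rpow_one] at hpl

end SymmetricConvex

/-- A finite family of open intervals of the line, possibly touching but not overlapping. It is
the family of those `Metric.ball (center i) (radius i)` with `i ∈ index`; the values of `center`
and `radius` at other integers are irrelevant. -/
structure IntervalFamily where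
  index : Finset ℤ
  center : ℤ → ℝ
  radius : ℤ → ℝ
  radius_pos : ∀ i, 0 < radius i
  separated : ∀ ⦃p q⦄, p ∈ index → q ∈ index → p ≠ q →
    radius p + radius q ≤ dist (center p) (center q)

namespace IntervalFamily

/-- The union of the intervals of the family. -/
def toSet (F : IntervalFamily) : Set ℝ := ⋃ i ∈ F.index, Metric.ball (F.center i) (F.radius i)

/-- Half of the total length of the intervals of the family. -/
def halfLength (F : IntervalFamily) : ℝ := ∑ i ∈ F.index, F.radius i

/-- The family obtained by multiplying all centers, but not the radii, by `τ`. -/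
def scale (F : IntervalFamily) (τ : ℝ) (hτ : ∀ ⦃p q⦄, p ∈ F.index → q ∈ F.index → p ≠ q →
    F.radius p + F.radius q ≤ dist (τ * F.center p) (τ * F.center q)) : IntervalFamily :=
  { F with center := fun i => τ * F.center i, separated := hτ }

theorem volume_toSet (F : IntervalFamily) :
    volume F.toSet = ENNReal.ofReal (2 * F.halfLength) := by
  have hdisj : (F.index : Set ℤ).PairwiseDisjoint fun i =>
      Metric.ball (F.center i) (F.radius i) :=
    fun p hp q hq hpq => Metric.ball_disjoint_ball (F.separated hp hq hpq)
  rw [toSet, measure_biUnion_finset hdisj fun _ _ => measurableSet_ball, halfLength,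
    Finset.mul_sum, ENNReal.ofReal_sum_of_nonneg fun i _ => by linarith [F.radius_pos i]]
  simp only [Real.volume_ball]

theorem toSet_scale_zero_subset (F : IntervalFamily) (h0) :
    (F.scale 0 h0).toSet ⊆ Metric.ball 0 F.halfLength := by
  refine iUnion₂_subset fun i hi => ?_
  simp only [scale, zero_mul]
  exact Metric.ball_subset_ball (Finset.single_le_sum (fun i _ => (F.radius_pos i).le) hi)

theorem radius_add_le_dist_of_touching (F : IntervalFamily) {p q i : ℤ} (hp : p ∈ F.index)
    (hq : q ∈ F.index) (hi : i ∈ F.index) (hip : i ≠ p) (hiq : i ≠ q)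
    (htouch : F.center q - F.center p = F.radius p + F.radius q) :
    F.radius i + (F.radius p + F.radius q) ≤
      dist (F.center i) ((F.center p - F.radius p + F.center q + F.radius q) / 2) := by
  have h1 := F.separated hi hp hip
  have h2 := F.separated hi hq hiq
  have hri := F.radius_pos i
  have hrp := F.radius_pos p
  have hrq := F.radius_pos q
  rw [Real.dist_eq, le_abs] at h1 h2 ⊢
  rcases h1 with h1 | h1 <;> rcases h2 with h2 | h2
  · left; linarith
  -- The `i`-th interval does not fit between `p` and `q`.
  · linarith
  · linarith
  · right; linarith

theorem exists_merge (F : IntervalFamily) {p q : ℤ} (hp : p ∈ F.index) (hq : q ∈ F.index)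
    (hpq : p ≠ q) (htouch : dist (F.center p) (F.center q) = F.radius p + F.radius q) :
    ∃ G : IntervalFamily, G.index.card < F.index.card ∧ G.halfLength = F.halfLength ∧
      F.toSet ⊆ G.toSet := by
  wlog hle : F.center p ≤ F.center q generalizing p q
  · exact this hq hp hpq.symm (by rw [dist_comm, htouch, add_comm]) (le_of_not_ge hle)
  have hp' : p ∈ F.index.erase q := Finset.mem_erase.2 ⟨hpq, hp⟩
  rw [Real.dist_eq, abs_sub_comm, abs_of_nonneg (sub_nonneg.2 hle)] at htouch
  set c := (F.center p - F.radius p + F.center q + F.radius q) / 2 with hc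
  have hrp := F.radius_pos p
  have hrq := F.radius_pos q
  refine ⟨⟨F.index.erase q, Function.update F.center p c,
    Function.update F.radius p (F.radius p + F.radius q), fun i => ?_, ?_⟩, ?_, ?_, ?_⟩
  · rcases eq_or_ne i p with rfl | hi
    · simpa using add_pos hrp hrq
    · simpa [hi] using F.radius_pos i
  · intro a b ha hb hab
    obtain ⟨haq, ha⟩ := Finset.mem_erase.1 ha
    obtain ⟨hbq, hb⟩ := Finset.mem_erase.1 hb
    rcases eq_or_ne a p with rfl | hap
    · rw [dist_comm, add_comm]
      simpa [hab.symm] using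
        F.radius_add_le_dist_of_touching hp hq hb hab.symm hbq htouch
    · rcases eq_or_ne b p with rfl | hbp
      · simpa [hap] using F.radius_add_le_dist_of_touching hp hq ha hap haq htouch
      · simpa [hap, hbp] using F.separated ha hb hab
  · exact Finset.card_erase_lt_of_mem hq
  · simp only [halfLength]
    rw [← Finset.add_sum_erase _ _ hp', ← Finset.add_sum_erase _ F.radius hq,
      ← Finset.add_sum_erase _ F.radius hp', Function.update_self,
      Finset.sum_congr rfl fun i hi => Function.update_of_ne (Finset.ne_of_mem_erase hi) _ _]
    ring
  · refine iUnion₂_subset fun i hi => ?_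
    by_cases hipq : i = p ∨ i = q
    · refine subset_iUnion₂_of_subset p hp' ?_
      simp only [Function.update_self, Real.ball_eq_Ioo]
      rcases hipq with rfl | rfl <;> exact Ioo_subset_Ioo (by linarith) (by linarith)
    · obtain ⟨hip, hiq⟩ := not_or.1 hipq
      refine subset_iUnion₂_of_subset i (Finset.mem_erase.2 ⟨hiq, hi⟩) ?_
      simp only [Function.update_of_ne hip, subset_refl]

section SymmetricConvex

variable {ι : Type*}

theorem exists_scale_touching [Finite ι] (F : ι → IntervalFamily) {j : ι}
    (hj : 1 < (F j).index.card) :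
    ∃ τ : ℝ, 0 ≤ τ ∧ τ ≤ 1 ∧
      (∀ j, ∀ ⦃p q⦄, p ∈ (F j).index → q ∈ (F j).index → p ≠ q →
        (F j).radius p + (F j).radius q ≤ dist (τ * (F j).center p) (τ * (F j).center q)) ∧
      ∃ j, ∃ p ∈ (F j).index, ∃ q ∈ (F j).index, p ≠ q ∧
        dist (τ * (F j).center p) (τ * (F j).center q) = (F j).radius p + (F j).radius q := by
  have := Fintype.ofFinite ι
  obtain ⟨a, ha, b, hb, hab⟩ := Finset.one_lt_card.1 hj
  -- The pair that touches first is the one with the largest ratio of radii to distance.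
  obtain ⟨⟨j, p, q⟩, hmem, hmax⟩ :=
    (Finset.univ.sigma fun j => (F j).index.offDiag).exists_max_image
      (fun z => ((F z.1).radius z.2.1 + (F z.1).radius z.2.2) /
        dist ((F z.1).center z.2.1) ((F z.1).center z.2.2)) ⟨⟨j, a, b⟩, by simp [ha, hb, hab]⟩
  simp only [Finset.mem_sigma, Finset.mem_univ, true_and, Finset.mem_offDiag] at hmem hmax
  obtain ⟨hp, hq, hpq⟩ := hmem
  have hpos (j) {p q} (hp : p ∈ (F j).index) (hq : q ∈ (F j).index) (hpq : p ≠ q) :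
      0 < dist ((F j).center p) ((F j).center q) :=
    (add_pos ((F j).radius_pos p) ((F j).radius_pos q)).trans_le ((F j).separated hp hq hpq)
  set τ := ((F j).radius p + (F j).radius q) / dist ((F j).center p) ((F j).center q)
  have hτ : 0 ≤ τ :=
    div_nonneg (add_pos ((F j).radius_pos p) ((F j).radius_pos q)).le dist_nonneg
  have hdist (x y : ℝ) : dist (τ * x) (τ * y) = τ * dist x y := by
    rw [Real.dist_eq, Real.dist_eq, ← mul_sub, abs_mul, abs_of_nonneg hτ]
  exact ⟨τ, hτ, (div_le_one (hpos j hp hq hpq)).2 ((F j).separated hp hq hpq),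
    fun j p q hp hq hpq => (div_le_iff₀ (hpos j hp hq hpq)).1 (hmax ⟨j, p, q⟩ ⟨hp, hq, hpq⟩)
      |>.trans_eq (hdist _ _).symm,
    j, p, hp, q, hq, hpq,
    (hdist _ _).trans (div_mul_cancel₀ _ (hpos j hp hq hpq).ne')⟩

variable [Fintype ι]

theorem univ_pi_toSet [DecidableEq ι] (F : ι → IntervalFamily) :
    (univ.pi fun j => (F j).toSet) = ⋃ σ ∈ Fintype.piFinset fun j => (F j).index,
      univ.pi fun j => Metric.ball ((F j).center (σ j)) ((F j).radius (σ j)) := by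
  ext x
  simp only [toSet, mem_univ_pi, mem_iUnion, Fintype.mem_piFinset, exists_prop]
  exact ⟨fun h => (Classical.skolem.1 h).imp fun σ hσ => forall_and.1 hσ,
    fun ⟨σ, h, h'⟩ j => ⟨σ j, h j, h' j⟩⟩

theorem pairwiseDisjoint_pi_ball [DecidableEq ι] (F : ι → IntervalFamily) :
    ((Fintype.piFinset fun j => (F j).index : Finset (ι → ℤ)) : Set (ι → ℤ)).PairwiseDisjoint
      fun σ => univ.pi fun j => Metric.ball ((F j).center (σ j)) ((F j).radius (σ j)) := by
  intro σ hσ σ' hσ' hne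
  obtain ⟨j, hj⟩ := Function.ne_iff.1 hne
  simp only [Finset.mem_coe, Fintype.mem_piFinset] at hσ hσ'
  exact disjoint_univ_pi.2 ⟨j, Metric.ball_disjoint_ball ((F j).separated (hσ j) (hσ' j) hj)⟩

variable {M : Set (ι → ℝ)} (hM : MeasurableSet M) (hMc : Convex ℝ M) (hMs : ∀ x ∈ M, -x ∈ M)

include hM hMc hMs

theorem volume_inter_pi_ball_le_scale (c r : ι → ℝ) {τ : ℝ} (h0 : 0 ≤ τ) (h1 : τ ≤ 1) :
    volume (M ∩ univ.pi fun j => Metric.ball (c j) (r j)) ≤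
      volume (M ∩ univ.pi fun j => Metric.ball (τ * c j) (r j)) := by
  have hpre (v : ι → ℝ) : (univ.pi fun j => Metric.ball (v j) (r j)) =
      (· - v) ⁻¹' univ.pi fun j => Metric.ball 0 (r j) := by
    ext x
    simp [Real.dist_eq]
  rw [hpre, hpre fun j => τ * c j]
  exact volume_inter_translate_le hM hMc hMs (MeasurableSet.univ_pi fun _ => measurableSet_ball)
    (convex_pi fun _ _ => convex_ball _ _) (by simp) c h0 h1

theorem volume_inter_pi_toSet_le_scale (F : ι → IntervalFamily) {τ : ℝ} (h0 : 0 ≤ τ)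
    (h1 : τ ≤ 1) (hτ : ∀ j, ∀ ⦃p q⦄, p ∈ (F j).index → q ∈ (F j).index → p ≠ q →
      (F j).radius p + (F j).radius q ≤ dist (τ * (F j).center p) (τ * (F j).center q)) :
    volume (M ∩ univ.pi fun j => (F j).toSet) ≤
      volume (M ∩ univ.pi fun j => ((F j).scale τ (hτ j)).toSet) := by
  classical
  rw [univ_pi_toSet fun j => (F j).scale τ (hτ j), inter_iUnion₂,
    measure_biUnion_finset ((pairwiseDisjoint_pi_ball _).mono fun _ => inter_subset_right)
      fun σ _ => hM.inter (MeasurableSet.univ_pi fun _ => measurableSet_ball),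
    univ_pi_toSet, inter_iUnion₂]
  exact (measure_biUnion_finset_le _ _).trans (Finset.sum_le_sum fun σ _ =>
    volume_inter_pi_ball_le_scale hM hMc hMs _ _ h0 h1)

theorem exists_fewer_intervals (F : ι → IntervalFamily) {j : ι} (hj : 1 < (F j).index.card) :
    ∃ G : ι → IntervalFamily, ∑ j, (G j).index.card < ∑ j, (F j).index.card ∧
      (∀ j, (G j).halfLength = (F j).halfLength) ∧
      volume (M ∩ univ.pi fun j => (F j).toSet) ≤ volume (M ∩ univ.pi fun j => (G j).toSet) := by
  classical
  obtain ⟨τ, h0, h1, hτ, j, p, hp, q, hq, hpq, htouch⟩ := exists_scale_touching F hj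
  obtain ⟨G, hcard, hlength, hsub⟩ := ((F j).scale τ (hτ j)).exists_merge hp hq hpq htouch
  refine ⟨Function.update (fun j => (F j).scale τ (hτ j)) j G, ?_, fun i => ?_,
    (volume_inter_pi_toSet_le_scale hM hMc hMs F h0 h1 hτ).trans
      (measure_mono (inter_subset_inter_right _ (pi_mono fun i _ => ?_)))⟩
  · refine Finset.sum_lt_sum (fun i _ => ?_) ⟨j, Finset.mem_univ j, by simpa [scale] using hcard⟩
    rcases eq_or_ne i j with rfl | hi
    · simpa [scale] using hcard.le
    · simp [hi, scale]
  · rcases eq_or_ne i j with rfl | hi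
    · simpa [scale, halfLength] using hlength
    · simp [hi, scale, halfLength]
  · rcases eq_or_ne i j with rfl | hi
    · simpa using hsub
    · simp [hi]

theorem volume_inter_pi_toSet_le (F : ι → IntervalFamily) :
    volume (M ∩ univ.pi fun j => (F j).toSet) ≤
      volume (M ∩ univ.pi fun j => Metric.ball 0 (F j).halfLength) := by
  induction hN : ∑ j, (F j).index.card using Nat.strong_induction_on generalizing F with
  | h N ih =>
    by_cases hcard : ∀ j, (F j).index.card ≤ 1
    · have hsep (j) ⦃p q⦄ (hp : p ∈ (F j).index) (hq : q ∈ (F j).index) (hpq : p ≠ q) :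
          (F j).radius p + (F j).radius q ≤ dist (0 * (F j).center p) (0 * (F j).center q) :=
        absurd (Finset.card_le_one.1 (hcard j) p hp q hq) hpq
      exact (volume_inter_pi_toSet_le_scale hM hMc hMs F le_rfl zero_le_one hsep).trans
        (measure_mono (inter_subset_inter_right _
          (pi_mono fun j _ => (F j).toSet_scale_zero_subset (hsep j))))
    · push Not at hcard
      obtain ⟨G, hlt, hlength, hle⟩ := exists_fewer_intervals hM hMc hMs F hcard.choose_spec
      simpa only [hlength] using hle.trans (ih _ (hN ▸ hlt) G rfl)

end SymmetricConvex

open scoped Classical in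
/-- The cells `((i : ℝ) / N, (i + 1) / N)`, `-N² ≤ i < N²`, with `N = n + 1`, that lie in `O`. -/
noncomputable def grid (n : ℕ) (O : Set ℝ) : IntervalFamily where
  index := (Finset.Ico (-(((n : ℤ) + 1) ^ 2)) (((n : ℤ) + 1) ^ 2)).filter fun i =>
    Metric.ball ((i + 1 / 2) / (n + 1) : ℝ) (1 / 2 / (n + 1)) ⊆ O
  center i := (i + 1 / 2) / (n + 1)
  radius _ := 1 / 2 / (n + 1)
  radius_pos _ := by positivity
  separated p q _ _ hpq := by
    have hn : (0 : ℝ) < n + 1 := by positivity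
    have hcenter : ((p : ℝ) + 1 / 2) / (n + 1) - (q + 1 / 2) / (n + 1) = (p - q) / (n + 1) := by
      ring
    have hone : (1 : ℝ) ≤ |(p : ℝ) - q| := by
      exact_mod_cast Int.one_le_abs (sub_ne_zero.2 hpq)
    rw [Real.dist_eq, hcenter, abs_div, abs_of_pos hn, ← add_div, add_halves]
    gcongr

open scoped Classical in
theorem toSet_grid_subset (n : ℕ) (O : Set ℝ) : (grid n O).toSet ⊆ O :=
  iUnion₂_subset fun _ hi => (Finset.mem_filter.1 hi).2

open scoped Classical in
theorem eventually_mem_toSet_grid {O : Set ℝ} (hO : IsOpen O) {x : ℝ} (hx : x ∈ O)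
    (hirr : Irrational x) : ∀ᶠ n : ℕ in Filter.atTop, x ∈ (grid n O).toSet := by
  obtain ⟨ε, hε, hball⟩ := Metric.isOpen_iff.1 hO x hx
  filter_upwards [Filter.eventually_ge_atTop ⌈max |x| (1 / ε)⌉₊] with n hn
  obtain ⟨hxn, hεn⟩ := max_le_iff.1 (Nat.ceil_le.1 hn)
  set N : ℝ := (n : ℝ) + 1 with hN
  have hN0 : 0 < N := by positivity
  obtain ⟨hx1, hx2⟩ := abs_le.1 hxn
  set i := ⌊N * x⌋ with hi
  have hfloor : (i : ℝ) < N * x := by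
    refine (Int.floor_le _).lt_of_ne fun h => hirr ⟨i / ((n + 1 : ℕ) : ℚ), ?_⟩
    push_cast
    rw [h, ← hN, mul_div_cancel_left₀ _ hN0.ne']
  have hceil := Int.lt_floor_add_one (N * x)
  have hcell : x ∈ Metric.ball ((i + 1 / 2) / N : ℝ) (1 / 2 / N) := by
    have hsub : x - (i + 1 / 2) / N = (N * x - i - 1 / 2) / N := by
      field_simp
      ring
    rw [Metric.mem_ball, Real.dist_eq, hsub, abs_div, abs_of_pos hN0]
    gcongr
    rw [abs_lt]
    constructor <;> linarith
  refine mem_iUnion₂.2 ⟨i, Finset.mem_filter.2 ⟨Finset.mem_Ico.2 ⟨?_, ?_⟩, fun y hy => ?_⟩, hcell⟩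
  · rw [hi, Int.le_floor]
    push_cast
    nlinarith
  · rw [hi, Int.floor_lt]
    push_cast
    nlinarith
  · refine hball ?_
    have hwidth : 1 / 2 / N + 1 / 2 / N < ε := by
      rw [← add_div, add_halves, div_lt_comm₀ hN0 hε]
      linarith
    exact (dist_triangle_right y x _).trans_lt ((add_lt_add hy hcell).trans hwidth)

end IntervalFamily

section SymmetricConvex

variable {ι : Type*} [Fintype ι] {M : Set (ι → ℝ)} (hM : MeasurableSet M) (hMc : Convex ℝ M)
  (hMs : ∀ x ∈ M, -x ∈ M)

include hM hMc hMs

theorem volume_inter_pi_isOpen_le {O : ι → Set ℝ} (hO : ∀ j, IsOpen (O j)) {ρ : ι → ℝ}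
    (hρ : ∀ j, 0 ≤ ρ j) (hvol : ∀ j, volume (O j) ≤ ENNReal.ofReal (2 * ρ j)) :
    volume (M ∩ univ.pi O) ≤ volume (M ∩ univ.pi fun j => Metric.ball 0 (ρ j)) := by
  set G : ℕ → Set (ι → ℝ) := fun n => univ.pi fun j => (IntervalFamily.grid n (O j)).toSet
  have hG (n : ℕ) : volume (M ∩ G n) ≤ volume (M ∩ univ.pi fun j => Metric.ball 0 (ρ j)) := by
    refine (IntervalFamily.volume_inter_pi_toSet_le hM hMc hMs _).trans
      (measure_mono (inter_subset_inter_right _ (pi_mono fun j _ => Metric.ball_subset_ball ?_)))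
    have h := (measure_mono (IntervalFamily.toSet_grid_subset n (O j))).trans (hvol j)
    rw [IntervalFamily.volume_toSet, ENNReal.ofReal_le_ofReal_iff (by linarith [hρ j])] at h
    linarith
  have hirr : ∀ᵐ x : ι → ℝ, ∀ j, Irrational (x j) :=
    ae_all_iff.2 fun j => (ae_all_iff.2 fun q : ℚ => Measure.ae_eval_ne _ j (q : ℝ)).mono
      fun x hx ⟨q, hq⟩ => hx q hq.symm
  calc volume (M ∩ univ.pi O)
      ≤ volume (⋃ n, ⋂ m ≥ n, M ∩ G m) := by
        refine measure_mono_ae ?_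
        filter_upwards [hirr] with x hx hxO
        obtain ⟨n, hn⟩ := Filter.eventually_atTop.1 <| Filter.eventually_all.2 fun j =>
          IntervalFamily.eventually_mem_toSet_grid (hO j) (hxO.2 j (mem_univ j)) (hx j)
        exact mem_iUnion.2 ⟨n, mem_iInter₂.2 fun m hm => ⟨hxO.1, fun j _ => hn m hm j⟩⟩
    _ = ⨆ n, volume (⋂ m ≥ n, M ∩ G m) := by
        refine Monotone.measure_iUnion fun a b hab => ?_
        exact biInter_subset_biInter_left fun m (hm : m ≥ b) => hab.trans hm
    _ ≤ _ := iSup_le fun n => (measure_mono (biInter_subset_of_mem le_rfl)).trans (hG n)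

theorem volume_inter_pi_le_pi_ball_add {A : ι → Set ℝ} (hA : ∀ j, volume (A j) ≠ ∞) {δ : ℝ}
    (hδ : 0 < δ) :
    volume (M ∩ univ.pi A) ≤
      volume (M ∩ univ.pi fun j => Metric.ball 0 (volume.real (A j) / 2 + δ)) := by
  have hcover (j) : ∃ U ⊇ A j, IsOpen U ∧
      volume U ≤ ENNReal.ofReal (2 * (volume.real (A j) / 2 + δ)) := by
    obtain ⟨U, hAU, hU, hlt⟩ := (A j).exists_isOpen_lt_add (hA j)
      (ε := ENNReal.ofReal (2 * δ)) (by simp [hδ])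
    refine ⟨U, hAU, hU, hlt.le.trans_eq ?_⟩
    rw [mul_add, mul_div_cancel₀ _ two_ne_zero,
      ENNReal.ofReal_add measureReal_nonneg (by positivity), ofReal_measureReal (hA j)]
  choose U hAU hU hvol using hcover
  exact (measure_mono (inter_subset_inter_right _ (pi_mono fun j _ => hAU j))).trans
    (volume_inter_pi_isOpen_le hM hMc hMs hU (fun j => by positivity) hvol)

/-- The Brascamp–Lieb–Luttinger inequality on the line, for a symmetric convex weight. -/
theorem volume_inter_pi_le_pi_ball_real {A : ι → Set ℝ} (hA : ∀ j, volume (A j) ≠ ∞) :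
    volume (M ∩ univ.pi A) ≤
      volume (M ∩ univ.pi fun j => Metric.ball 0 (volume.real (A j) / 2)) := by
  set ρ : ι → ℝ := fun j => volume.real (A j) / 2
  set B : ℕ → Set (ι → ℝ) := fun n => M ∩ univ.pi fun j => Metric.ball 0 (ρ j + 1 / (n + 1))
  have hB : ⋂ n, B n ⊆ M ∩ univ.pi fun j => Metric.closedBall 0 (ρ j) := fun x hx => by
    rw [mem_iInter] at hx
    refine ⟨(hx 0).1, fun j _ => ?_⟩
    have hlim :
        Filter.Tendsto (fun n : ℕ => ρ j + 1 / ((n : ℝ) + 1)) Filter.atTop (nhds (ρ j)) := by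
      simpa using tendsto_one_div_add_atTop_nhds_zero_nat.const_add (ρ j)
    exact ge_of_tendsto' hlim fun n => (Metric.mem_ball.1 ((hx n).2 j (mem_univ j))).le
  have hanti : Antitone B := fun m n hmn => inter_subset_inter_right _ <| pi_mono fun j _ =>
    Metric.ball_subset_ball (by gcongr)
  have hfin : volume (B 0) ≠ ∞ := measure_ne_top_of_subset inter_subset_right <| by
    rw [volume_pi_pi]
    exact ENNReal.prod_ne_top fun _ _ => measure_ball_lt_top.ne
  calc volume (M ∩ univ.pi A)
      ≤ ⨅ n, volume (B n) :=
        le_iInf fun n => volume_inter_pi_le_pi_ball_add hM hMc hMs hA (by positivity)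
    _ = volume (⋂ n, B n) := by
        refine (hanti.measure_iInter (fun n => ?_) ⟨0, hfin⟩).symm
        exact (hM.inter (MeasurableSet.univ_pi fun _ => measurableSet_ball)).nullMeasurableSet
    _ ≤ volume (M ∩ univ.pi fun j => Metric.closedBall 0 (ρ j)) := measure_mono hB
    _ = volume (M ∩ univ.pi fun j => Metric.ball 0 (ρ j)) := by
        simp only [Real.ball_eq_Ioo, Real.closedBall_eq_Icc, pi_univ_Icc]
        exact measure_congr ((ae_eq_refl M).inter Measure.univ_pi_Ioo_ae_eq_Icc.symm)

end SymmetricConvex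

section SteinerSymmetrization

variable {E ι : Type*} [NormedAddCommGroup E] [InnerProductSpace ℝ E]

noncomputable section

/-- The section of `A` by the line through `y` in direction `θ`, as a set of parameters. -/
def lineFiber (θ : E) (A : Set E) (y : E) : Set ℝ :=
  {t | y + t • θ ∈ A}

/-- The section of `L ⊆ E^ι` through `y` along the directions `t ↦ (t_j θ)_j`, as a set of
parameters. -/
def lineFiberPi (θ : E) (L : Set (ι → E)) (y : ι → E) : Set (ι → ℝ) :=
  {t | (fun j => y j + t j • θ) ∈ L}

/-- The Steiner symmetrization of `A` with respect to the hyperplane orthogonal to the unit vector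
`θ`: every section of `A` by a line in direction `θ` is replaced by the open segment of the same
length centred on the hyperplane. -/
def steinerSymm (θ : E) (A : Set E) : Set E :=
  {x | 2 * ENNReal.ofReal |inner ℝ θ x| < volume (lineFiber θ A x)}

/-- The sections of `L ⊆ E^ι` along every single direction of `E` are convex and symmetric about
the hyperplane orthogonal to that direction. -/
def IsSteinerConvex (L : Set (ι → E)) : Prop :=
  ∀ θ : E, ‖θ‖ = 1 → ∀ y : ι → E, (∀ j, inner ℝ θ (y j) = 0) →
    Convex ℝ (lineFiberPi θ L y) ∧ ∀ t ∈ lineFiberPi θ L y, -t ∈ lineFiberPi θ L y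

end

theorem setOf_two_mul_ofReal_abs_lt {c : ℝ≥0∞} (hc : c ≠ ∞) :
    {t : ℝ | 2 * ENNReal.ofReal |t| < c} = Metric.ball 0 (c.toReal / 2) := by
  ext t
  rw [mem_ofPred_eq, mem_ball_zero_iff, Real.norm_eq_abs, ← ENNReal.ofReal_ofNat,
    ← ENNReal.ofReal_mul (by norm_num), ENNReal.ofReal_lt_iff_lt_toReal (by positivity) hc,
    lt_div_iff₀' (by norm_num)]

theorem volume_setOf_two_mul_ofReal_abs_lt (c : ℝ≥0∞) :
    volume {t : ℝ | 2 * ENNReal.ofReal |t| < c} = c := by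
  rcases eq_or_ne c ∞ with rfl | hc
  · simp [ENNReal.mul_lt_top_iff]
  · rw [setOf_two_mul_ofReal_abs_lt hc, Real.volume_ball, mul_div_cancel₀ _ two_ne_zero,
      ENNReal.ofReal_toReal hc]

theorem lineFiber_steinerSymm {θ : E} (hθ : ‖θ‖ = 1) (A : Set E) {y : E} (hy : inner ℝ θ y = 0) :
    lineFiber θ (steinerSymm θ A) y = {t | 2 * ENNReal.ofReal |t| < volume (lineFiber θ A y)} := by
  ext t
  have hinner : inner ℝ θ (y + t • θ) = t := by
    simp [inner_add_right, hy, inner_smul_right, hθ]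
  have hvol : volume (lineFiber θ A (y + t • θ)) = volume (lineFiber θ A y) := by
    rw [← measure_preimage_add volume t (lineFiber θ A y)]
    simp [lineFiber, add_smul, add_assoc]
  simp only [lineFiber, steinerSymm, mem_ofPred_eq, hinner] at hvol ⊢
  rw [hvol]

theorem lineFiber_steinerSymm_eq_ball {θ : E} (hθ : ‖θ‖ = 1) {A : Set E} {y : E}
    (hy : inner ℝ θ y = 0) (hA : volume (lineFiber θ A y) ≠ ∞) :
    lineFiber θ (steinerSymm θ A) y = Metric.ball 0 (volume.real (lineFiber θ A y) / 2) :=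
  (lineFiber_steinerSymm hθ A hy).trans (setOf_two_mul_ofReal_abs_lt hA)

theorem exists_lineFiber_ball_eq {θ : E} (hθ : ‖θ‖ = 1) {y : E} (hy : inner ℝ θ y = 0) (r : ℝ) :
    ∃ s, lineFiber θ (Metric.ball 0 r) y = Metric.ball 0 s := by
  rcases lt_or_ge r 0 with hr | hr
  · exact ⟨0, by simp [lineFiber, Metric.ball_eq_empty.2 hr.le]⟩
  refine ⟨√(r ^ 2 - ‖y‖ ^ 2), ?_⟩
  ext t
  have hnorm : ‖y + t • θ‖ ^ 2 = ‖y‖ ^ 2 + t ^ 2 := by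
    rw [norm_add_sq_real, inner_smul_right, real_inner_comm, hy, norm_smul, hθ]
    simp
  rw [lineFiber, mem_ofPred_eq, mem_ball_zero_iff, mem_ball_zero_iff, Real.norm_eq_abs,
    ← sq_lt_sq₀ (norm_nonneg _) hr, hnorm, Real.lt_sqrt (abs_nonneg _), sq_abs, lt_sub_iff_add_lt']

theorem volume_lineFiber_ne_top {θ : E} (hθ : ‖θ‖ = 1) {A : Set E} {R : ℝ}
    (hR : A ⊆ Metric.ball 0 R) {y : E} (hy : inner ℝ θ y = 0) : volume (lineFiber θ A y) ≠ ∞ := by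
  obtain ⟨s, hs⟩ := exists_lineFiber_ball_eq hθ hy R
  have hsub : lineFiber θ A y ⊆ Metric.ball 0 s := hs ▸ fun _ ht => hR ht
  exact measure_ne_top_of_subset hsub measure_ball_lt_top.ne

theorem steinerSymm_subset_ball {θ : E} (hθ : ‖θ‖ = 1) {A : Set E} {R : ℝ}
    (hR : A ⊆ Metric.ball 0 R) : steinerSymm θ A ⊆ Metric.ball 0 R := by
  intro x hx
  set t : ℝ := inner ℝ θ x
  have hy : inner ℝ θ (x - t • θ) = 0 := by
    simp [inner_sub_right, inner_smul_right, hθ, t]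
  have hxy : x - t • θ + t • θ = x := sub_add_cancel _ _
  obtain ⟨s, hs⟩ := exists_lineFiber_ball_eq hθ hy R
  have hfin := volume_lineFiber_ne_top hθ hR hy
  have hle : volume.real (lineFiber θ A (x - t • θ)) / 2 ≤ max s 0 := by
    have hsub : lineFiber θ A (x - t • θ) ⊆ Metric.ball 0 s := hs ▸ fun _ ht => hR ht
    have := measureReal_mono hsub (μ := volume) measure_ball_lt_top.ne
    rw [Measure.real, Measure.real, Real.volume_ball, ENNReal.toReal_ofReal'] at this
    rw [Measure.real, div_le_iff₀' two_pos, mul_max_of_nonneg _ _ two_pos.le, mul_zero]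
    exact this
  have ht : t ∈ lineFiber θ (steinerSymm θ A) (x - t • θ) := by rwa [lineFiber, mem_ofPred_eq, hxy]
  rw [lineFiber_steinerSymm_eq_ball hθ hy hfin] at ht
  have ht' : t ∈ lineFiber θ (Metric.ball 0 R) (x - t • θ) := by
    rw [hs]
    rw [mem_ball_zero_iff] at ht ⊢
    exact (lt_max_iff.1 (ht.trans_le hle)).resolve_right (norm_nonneg t).not_gt
  rwa [lineFiber, mem_ofPred_eq, hxy] at ht'

theorem inner_coe_orthogonal_span (θ : E) (y : (Submodule.span ℝ {θ})ᗮ) : inner ℝ θ (y : E) = 0 :=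
  Submodule.mem_orthogonal_singleton_iff_inner_right.1 y.2

variable [MeasurableSpace E] [BorelSpace E]

theorem measurableSet_lineFiber {A : Set E} (hA : MeasurableSet A) (θ y : E) :
    MeasurableSet (lineFiber θ A y) :=
  hA.preimage (by fun_prop)

theorem measurableSet_lineFiberPi {L : Set (ι → E)} (hL : MeasurableSet L) (θ : E) (y : ι → E) :
    MeasurableSet (lineFiberPi θ L y) :=
  hL.preimage (by fun_prop)

variable [FiniteDimensional ℝ E]

theorem measurable_volume_lineFiber {A : Set E} (hA : MeasurableSet A) (θ : E) :
    Measurable fun y => volume (lineFiber θ A y) :=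
  measurable_measure_prodMk_left (s := {p : E × ℝ | p.1 + p.2 • θ ∈ A}) (hA.preimage (by fun_prop))

theorem measurableSet_steinerSymm {A : Set E} (hA : MeasurableSet A) (θ : E) :
    MeasurableSet (steinerSymm θ A) :=
  measurableSet_lt (by fun_prop) (measurable_volume_lineFiber hA θ)

theorem volume_centred_diff_add_le {a : Set ℝ} (ha : MeasurableSet a) (hfin : volume a ≠ ∞)
    (s τ : ℝ) :
    volume (Metric.ball (0 : ℝ) (volume.real a / 2) \ Metric.ball 0 s) +
      volume ((a \ Metric.ball 0 s) ∩ (· + τ) ⁻¹' (Metric.ball 0 s \ a)) ≤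
      volume (a \ Metric.ball 0 s) := by
  set b := Metric.ball (0 : ℝ) s
  have hb : MeasurableSet b := measurableSet_ball
  have hbfin : volume b ≠ ∞ := measure_ball_lt_top.ne
  rcases le_total (volume.real a / 2) s with h | h
  · rw [sdiff_eq_empty.2 (Metric.ball_subset_ball h), measure_empty, zero_add]
    exact measure_mono inter_subset_left
  · have hcentred : volume (Metric.ball (0 : ℝ) (volume.real a / 2)) = volume a := by
      rw [Real.volume_ball, mul_div_cancel₀ _ two_ne_zero, ofReal_measureReal hfin]
    have hba : volume b ≤ volume a := hcentred ▸ measure_mono (Metric.ball_subset_ball h)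
    have hbalance : volume a - volume b + volume (b \ a) = volume (a \ b) := by
      refine (ENNReal.add_left_inj hbfin).1 ?_
      rw [add_right_comm, tsub_add_cancel_of_le hba, ← measure_union disjoint_sdiff_left hb,
        add_comm, ← measure_union disjoint_sdiff_left ha, sdiff_union_self, sdiff_union_self,
        union_comm]
    rw [measure_sdiff (Metric.ball_subset_ball h) hb.nullMeasurableSet hbfin, hcentred, ← hbalance]
    refine add_le_add_right ?_ _
    rw [← measure_preimage_add_right volume τ (b \ a)]
    exact measure_mono inter_subset_right

theorem measurePreserving_orthogonal_add {θ : E} (hθ : ‖θ‖ = 1) :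
    MeasurePreserving (fun p : (Submodule.span ℝ {θ})ᗮ × ℝ => (p.1 : E) + p.2 • θ)
      (volume.prod volume) volume := by
  set L := Submodule.span ℝ {θ}
  have hline : MeasurePreserving (LinearIsometryEquiv.toSpanUnitSingleton (𝕜 := ℝ) θ hθ)
      volume volume := LinearIsometryEquiv.measurePreserving _
  have hsum := (L.orthogonalDecomposition.symm.measurePreserving).comp
    (WithLp.volume_preserving_toLp L Lᗮ)
  convert! hsum.comp ((hline.prod (MeasurePreserving.id (volume : Measure Lᗮ))).comp
    (Measure.measurePreserving_swap (μ := (volume : Measure Lᗮ))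
      (ν := (volume : Measure ℝ)))) using 1
  ext p
  simp [add_comm]

theorem volume_eq_lintegral_lineFiber {θ : E} (hθ : ‖θ‖ = 1) {A : Set E} (hA : MeasurableSet A) :
    volume A = ∫⁻ y : (Submodule.span ℝ {θ})ᗮ, volume (lineFiber θ A y) := by
  rw [← (measurePreserving_orthogonal_add hθ).measure_preimage hA.nullMeasurableSet,
    Measure.prod_apply (hA.preimage (by fun_prop))]
  rfl

theorem volume_steinerSymm {θ : E} (hθ : ‖θ‖ = 1) {A : Set E} (hA : MeasurableSet A) :
    volume (steinerSymm θ A) = volume A := by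
  rw [volume_eq_lintegral_lineFiber hθ hA,
    volume_eq_lintegral_lineFiber hθ (measurableSet_steinerSymm hA θ)]
  refine lintegral_congr fun y => ?_
  rw [lineFiber_steinerSymm hθ A (inner_coe_orthogonal_span θ y),
    volume_setOf_two_mul_ofReal_abs_lt]

theorem volume_steinerSymm_diff_add_le {θ : E} (hθ : ‖θ‖ = 1) {A : Set E} (hA : MeasurableSet A)
    {R : ℝ} (hR : A ⊆ Metric.ball 0 R) (r τ : ℝ) :
    volume (steinerSymm θ A \ Metric.ball 0 r) +
      volume ((A \ Metric.ball 0 r) ∩ (· + τ • θ) ⁻¹' (Metric.ball 0 r \ A)) ≤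
      volume (A \ Metric.ball 0 r) := by
  set B := Metric.ball (0 : E) r
  have hB : MeasurableSet B := measurableSet_ball
  have hS := (measurableSet_steinerSymm hA θ).diff hB
  have hT : MeasurableSet ((A \ B) ∩ (· + τ • θ) ⁻¹' (B \ A)) :=
    (hA.diff hB).inter ((hB.diff hA).preimage (by fun_prop))
  rw [volume_eq_lintegral_lineFiber hθ hS, volume_eq_lintegral_lineFiber hθ hT,
    volume_eq_lintegral_lineFiber hθ (hA.diff hB),
    ← lintegral_add_left (by exact (measurable_volume_lineFiber hS θ).comp measurable_subtype_coe)]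
  refine lintegral_mono fun y => ?_
  have hy := inner_coe_orthogonal_span θ y
  obtain ⟨s, hs⟩ := exists_lineFiber_ball_eq hθ hy r
  have hfin := volume_lineFiber_ne_top hθ hR hy
  have key := volume_centred_diff_add_le (measurableSet_lineFiber hA θ y) hfin s τ
  rw [← hs, ← lineFiber_steinerSymm_eq_ball hθ hy hfin] at key
  convert! key using 3
  ext t
  simp only [lineFiber, mem_inter_iff, mem_sdiff, mem_preimage, mem_ofPred_eq, add_smul,
    add_assoc, B]

variable [Fintype ι]

theorem measurePreserving_pi_orthogonal_add {θ : E} (hθ : ‖θ‖ = 1) :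
    MeasurePreserving
      (fun (p : (ι → (Submodule.span ℝ {θ})ᗮ) × (ι → ℝ)) j => (p.1 j : E) + p.2 j • θ)
      (volume.prod volume) volume :=
  (measurePreserving_pi (fun _ : ι => volume.prod volume) (fun _ => volume)
    fun _ => measurePreserving_orthogonal_add hθ).comp
    (measurePreserving_arrowProdEquivProdArrow _ ℝ ι (fun _ => volume) fun _ => volume).symm

theorem volume_inter_pi_le_steinerSymm {L : Set (ι → E)} (hL : MeasurableSet L)
    (hLc : IsSteinerConvex L) {θ : E} (hθ : ‖θ‖ = 1) {A : ι → Set E}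
    (hA : ∀ j, MeasurableSet (A j)) {R : ℝ} (hR : ∀ j, A j ⊆ Metric.ball 0 R) :
    volume (L ∩ univ.pi A) ≤ volume (L ∩ univ.pi fun j => steinerSymm θ (A j)) := by
  have hmp := measurePreserving_pi_orthogonal_add (ι := ι) hθ
  have hLA : MeasurableSet (L ∩ univ.pi A) := hL.inter (.univ_pi hA)
  have hLS : MeasurableSet (L ∩ univ.pi fun j => steinerSymm θ (A j)) :=
    hL.inter (.univ_pi fun j => measurableSet_steinerSymm (hA j) θ)
  rw [← hmp.measure_preimage hLA.nullMeasurableSet, ← hmp.measure_preimage hLS.nullMeasurableSet,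
    Measure.prod_apply (hmp.measurable hLA), Measure.prod_apply (hmp.measurable hLS)]
  refine lintegral_mono fun y => ?_
  have hy : ∀ j, inner ℝ θ (y j : E) = 0 := fun j => inner_coe_orthogonal_span θ (y j)
  obtain ⟨hconv, hsymm⟩ := hLc θ hθ (fun j => y j) hy
  have hfin : ∀ j, volume (lineFiber θ (A j) (y j)) ≠ ∞ := fun j =>
    volume_lineFiber_ne_top hθ (hR j) (hy j)
  have hfiber : (fun j => lineFiber θ (steinerSymm θ (A j)) (y j : E)) =
      fun j => Metric.ball (0 : ℝ) (volume.real (lineFiber θ (A j) (y j)) / 2) :=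
    funext fun j => lineFiber_steinerSymm_eq_ball hθ (hy j) (hfin j)
  have key := volume_inter_pi_le_pi_ball_real (measurableSet_lineFiberPi hL θ _) hconv hsymm hfin
  rw [← hfiber] at key
  exact key

end SteinerSymmetrization

section RearrangementInequality

theorem exists_norm_eq_one_eq_smul {E : Type*} [NormedAddCommGroup E]
    [NormedSpace ℝ E] [Nontrivial E] (v : E) :
    ∃ θ : E, ‖θ‖ = 1 ∧ ∃ τ : ℝ, v = τ • θ := by
  rcases eq_or_ne v 0 with rfl | hv
  · obtain ⟨θ, hθ⟩ := exists_norm_eq E zero_le_one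
    exact ⟨θ, hθ, 0, (zero_smul ℝ θ).symm⟩
  · exact ⟨‖v‖⁻¹ • v, norm_smul_inv_norm hv, ‖v‖, by
      rw [smul_smul, mul_inv_cancel₀ (norm_ne_zero_iff.2 hv), one_smul]⟩

theorem iUnion_inter_pi_inter_ball {E ι : Type*} [SeminormedAddCommGroup E] [Finite ι]
    (L : Set (ι → E)) (A : ι → Set E) :
    ⋃ N : ℕ, L ∩ univ.pi (fun j => A j ∩ Metric.ball 0 N) = L ∩ univ.pi A := by
  have := Fintype.ofFinite ι
  refine subset_antisymm (iUnion_subset fun N => ?_) fun x ⟨hxL, hxA⟩ => ?_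
  · exact inter_subset_inter_right L (pi_mono fun j _ => inter_subset_left)
  · obtain ⟨N, hN⟩ := exists_nat_gt ‖x‖
    exact mem_iUnion.2 ⟨N, hxL, fun j _ =>
      ⟨hxA j trivial, mem_ball_zero_iff.2 ((norm_le_pi_norm x j).trans_lt hN)⟩⟩

theorem exists_lt_of_forall_exists_add_le {X : Type*} {D : X → ℝ≥0∞} {φ : ℝ≥0∞ → ℝ≥0∞}
    (hφ : Monotone φ) (hφ_ne : ∀ d ≠ 0, φ d ≠ 0) {x₀ : X} (hx₀ : D x₀ ≠ ∞)
    (hD : ∀ x, ∃ y, D y + φ (D x) ≤ D x) {ε : ℝ≥0∞} (hε : 0 < ε) : ∃ x, D x < ε := by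
  suffices hinf : ⨅ x, D x = 0 from iInf_lt_iff.1 (hinf.trans_lt hε)
  by_contra hinf
  -- One step from a near-minimizer of `D` would go below the positive infimum.
  obtain ⟨x, hx⟩ := iInf_lt_iff.1
    (ENNReal.lt_add_right (ne_top_of_le_ne_top hx₀ (iInf_le D x₀)) (hφ_ne _ hinf))
  obtain ⟨y, hy⟩ := hD x
  exact hx.not_ge ((add_le_add (iInf_le D y) (hφ (iInf_le D x))).trans hy)

theorem sq_sum_div_card_le_sum_sq {ι : Type*} [Fintype ι] (f : ι → ℝ≥0∞) :
    (∑ j, f j) ^ 2 / Fintype.card ι ≤ ∑ j, f j ^ 2 := by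
  refine ENNReal.div_le_of_le_mul' ?_
  have h := ENNReal.rpow_sum_le_const_mul_sum_rpow (s := Finset.univ) f one_le_two
  norm_num at h
  exact_mod_cast h

variable {E ι : Type*} [NormedAddCommGroup E] [InnerProductSpace ℝ E] [FiniteDimensional ℝ E]
  [MeasurableSpace E] [BorelSpace E]

theorem measurable_volume_inter_preimage_add {U V : Set E} (hU : MeasurableSet U)
    (hV : MeasurableSet V) : Measurable fun v => volume (U ∩ (· + v) ⁻¹' V) :=
  measurable_measure_prodMk_left (s := {p : E × E | p.2 ∈ U ∧ p.2 + p.1 ∈ V})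
    ((hU.preimage measurable_snd).inter (hV.preimage (measurable_snd.add measurable_fst)))

theorem lintegral_volume_inter_preimage_add {U V : Set E} (hU : MeasurableSet U)
    (hV : MeasurableSet V) :
    ∫⁻ v, volume (U ∩ (· + v) ⁻¹' V) = volume U * volume V := by
  set T : Set (E × E) := {p | p.2 ∈ U ∧ p.2 + p.1 ∈ V}
  have hT : MeasurableSet T :=
    (hU.preimage measurable_snd).inter (hV.preimage (measurable_snd.add measurable_fst))
  have hsection : ∀ x, volume ((fun v => (v, x)) ⁻¹' T) = U.indicator (fun _ => volume V) x := by
    intro x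
    by_cases hx : x ∈ U
    · rw [indicator_of_mem hx, ← measure_preimage_add volume x V]
      simp only [T, preimage, mem_ofPred_eq, hx, true_and]
    · simp [T, hx]
  calc ∫⁻ v, volume (U ∩ (· + v) ⁻¹' V) = (volume.prod volume) T := (Measure.prod_apply hT).symm
    _ = ∫⁻ x, U.indicator (fun _ => volume V) x := by
      rw [Measure.prod_apply_symm hT, lintegral_congr hsection]
    _ = volume U * volume V := by rw [lintegral_indicator_const hU, mul_comm]

variable [Fintype ι]

theorem exists_sum_volume_mul_le [Nontrivial E] {U V : ι → Set E} (hU : ∀ j, MeasurableSet (U j))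
    (hV : ∀ j, MeasurableSet (V j)) {R : ℝ} (hR : 0 < R) (hUR : ∀ j, U j ⊆ Metric.ball 0 R)
    (hVR : ∀ j, V j ⊆ Metric.ball 0 R) :
    ∃ v : E, (∑ j, volume (U j) * volume (V j)) / volume (Metric.ball (0 : E) (2 * R)) ≤
      ∑ j, volume (U j ∩ (· + v) ⁻¹' V j) := by
  set W := Metric.ball (0 : E) (2 * R)
  have hint : ∀ j, ∫⁻ v in W, volume (U j ∩ (· + v) ⁻¹' V j) = volume (U j) * volume (V j) := by
    intro j
    rw [setLIntegral_eq_of_support_subset, lintegral_volume_inter_preimage_add (hU j) (hV j)]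
    intro v hv
    obtain ⟨x, hxU, hxV⟩ := nonempty_of_measure_ne_zero hv
    have hx := mem_ball_zero_iff.1 (hUR j hxU)
    have hxv := mem_ball_zero_iff.1 (hVR j hxV)
    rw [mem_ball_zero_iff]
    calc ‖v‖ = ‖(x + v) - x‖ := by simp
      _ ≤ ‖x + v‖ + ‖x‖ := norm_sub_le _ _
      _ < 2 * R := by linarith
  have hsum : ∫⁻ v in W, ∑ j, volume (U j ∩ (· + v) ⁻¹' V j) =
      ∑ j, volume (U j) * volume (V j) := by
    rw [lintegral_finsetSum _ fun j _ => measurable_volume_inter_preimage_add (hU j) (hV j)]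
    exact Finset.sum_congr rfl fun j _ => hint j
  have hfin : ∑ j, volume (U j) * volume (V j) ≠ ∞ := ENNReal.sum_ne_top.2 fun j _ =>
    ENNReal.mul_ne_top (measure_ne_top_of_subset (hUR j) measure_ball_lt_top.ne)
      (measure_ne_top_of_subset (hVR j) measure_ball_lt_top.ne)
  obtain ⟨v, -, hv⟩ := exists_setLAverage_le (μ := volume) (s := W)
    (f := fun v => ∑ j, volume (U j ∩ (· + v) ⁻¹' V j))
    (Metric.measure_ball_pos _ _ (by positivity)).ne' measurableSet_ball.nullMeasurableSet
    (hsum ▸ hfin)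
  exact ⟨v, by rwa [setLAverage_eq, hsum] at hv⟩

theorem exists_sum_volume_steinerSymm_diff_add_le [Nontrivial E] {A : ι → Set E}
    (hA : ∀ j, MeasurableSet (A j)) {R : ℝ} (hR : 0 < R) (hAR : ∀ j, A j ⊆ Metric.ball 0 R)
    {r : ι → ℝ} (hr : ∀ j, r j ≤ R)
    (hvol : ∀ j, volume (A j) ≤ volume (Metric.ball (0 : E) (r j))) :
    ∃ θ : E, ‖θ‖ = 1 ∧
      ∑ j, volume (steinerSymm θ (A j) \ Metric.ball 0 (r j)) +
        (∑ j, volume (A j \ Metric.ball 0 (r j)) ^ 2) / volume (Metric.ball (0 : E) (2 * R)) ≤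
      ∑ j, volume (A j \ Metric.ball 0 (r j)) := by
  set B : ι → Set E := fun j => Metric.ball 0 (r j)
  have hB : ∀ j, MeasurableSet (B j) := fun j => measurableSet_ball
  have hBR : ∀ j, B j ⊆ Metric.ball 0 R := fun j => Metric.ball_subset_ball (hr j)
  have hdiff : ∀ j, volume (A j \ B j) ≤ volume (B j \ A j) := by
    intro j
    have hfin : volume (B j ∩ A j) ≠ ∞ :=
      measure_ne_top_of_subset inter_subset_left measure_ball_lt_top.ne
    refine (ENNReal.add_le_add_iff_right hfin).1 ?_
    rw [measure_sdiff_add_inter _ (hA j), inter_comm, measure_sdiff_add_inter _ (hB j)]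
    exact hvol j
  obtain ⟨v, hv⟩ := exists_sum_volume_mul_le (fun j => (hA j).diff (hB j))
    (fun j => (hB j).diff (hA j)) hR (fun j => sdiff_subset.trans (hAR j))
    (fun j => sdiff_subset.trans (hBR j))
  obtain ⟨θ, hθ, τ, rfl⟩ := exists_norm_eq_one_eq_smul v
  refine ⟨θ, hθ, ?_⟩
  calc ∑ j, volume (steinerSymm θ (A j) \ B j) +
        (∑ j, volume (A j \ B j) ^ 2) / volume (Metric.ball (0 : E) (2 * R))
      ≤ ∑ j, volume (steinerSymm θ (A j) \ B j) +
        (∑ j, volume (A j \ B j) * volume (B j \ A j)) / volume (Metric.ball (0 : E) (2 * R)) := by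
        simp only [sq]
        refine add_le_add_right (ENNReal.div_le_div_right ?_ _) _
        exact Finset.sum_le_sum fun j _ => mul_le_mul_right (hdiff j) _
    _ ≤ ∑ j, volume (steinerSymm θ (A j) \ B j) +
        ∑ j, volume ((A j \ B j) ∩ (· + τ • θ) ⁻¹' (B j \ A j)) := by gcongr
    _ ≤ ∑ j, volume (A j \ B j) := by
        rw [← Finset.sum_add_distrib]
        exact Finset.sum_le_sum fun j _ =>
          volume_steinerSymm_diff_add_le hθ (hA j) (hAR j) (r j) τ

theorem exists_sum_volume_diff_ball_lt [Nontrivial E] {L : Set (ι → E)} (hL : MeasurableSet L)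
    (hLc : IsSteinerConvex L) {A : ι → Set E} (hA : ∀ j, MeasurableSet (A j)) {R : ℝ} (hR : 0 < R)
    (hAR : ∀ j, A j ⊆ Metric.ball 0 R) {r : ι → ℝ} (hr : ∀ j, r j ≤ R)
    (hvol : ∀ j, volume (A j) ≤ volume (Metric.ball (0 : E) (r j))) {ε : ℝ≥0∞} (hε : 0 < ε) :
    ∃ A' : ι → Set E, (∀ j, A' j ⊆ Metric.ball 0 R) ∧
      volume (L ∩ univ.pi A) ≤ volume (L ∩ univ.pi A') ∧
      ∑ j, volume (A' j \ Metric.ball 0 (r j)) < ε := by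
  let S : Set (ι → Set E) := {A' | (∀ j, MeasurableSet (A' j)) ∧ (∀ j, A' j ⊆ Metric.ball 0 R) ∧
    (∀ j, volume (A' j) ≤ volume (Metric.ball (0 : E) (r j))) ∧
    volume (L ∩ univ.pi A) ≤ volume (L ∩ univ.pi A')}
  let φ : ℝ≥0∞ → ℝ≥0∞ := fun d => d ^ 2 / Fintype.card ι / volume (Metric.ball (0 : E) (2 * R))
  have hφ : Monotone φ := fun d d' hd => by simp only [φ]; gcongr
  have hφ_ne : ∀ d ≠ 0, φ d ≠ 0 := fun d hd => ENNReal.div_ne_zero.2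
    ⟨ENNReal.div_ne_zero.2 ⟨pow_ne_zero 2 hd, ENNReal.natCast_ne_top _⟩, measure_ball_lt_top.ne⟩
  have hgain : ∀ A' : S, ∃ A'' : S, ∑ j, volume (A''.1 j \ Metric.ball 0 (r j)) +
      φ (∑ j, volume (A'.1 j \ Metric.ball 0 (r j))) ≤
        ∑ j, volume (A'.1 j \ Metric.ball 0 (r j)) := by
    rintro ⟨A', hA', hAR', hvol', hle⟩
    obtain ⟨θ, hθ, hD⟩ := exists_sum_volume_steinerSymm_diff_add_le hA' hR hAR' hr hvol'
    refine ⟨⟨fun j => steinerSymm θ (A' j), fun j => measurableSet_steinerSymm (hA' j) θ,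
      fun j => steinerSymm_subset_ball hθ (hAR' j),
      fun j => (volume_steinerSymm hθ (hA' j)).trans_le (hvol' j),
      hle.trans (volume_inter_pi_le_steinerSymm hL hLc hθ hA' hAR')⟩, le_trans ?_ hD⟩
    exact add_le_add_right (ENNReal.div_le_div_right (sq_sum_div_card_le_sum_sq _) _) _
  have hfin : ∑ j, volume (A j \ Metric.ball 0 (r j)) ≠ ∞ := ENNReal.sum_ne_top.2 fun j _ =>
    measure_ne_top_of_subset (sdiff_subset.trans (hAR j)) measure_ball_lt_top.ne
  obtain ⟨⟨A', _, hAR', _, hle⟩, hD⟩ := exists_lt_of_forall_exists_add_le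
    (x₀ := (⟨A, hA, hAR, hvol, le_rfl⟩ : S)) hφ hφ_ne hfin hgain hε
  exact ⟨A', hAR', hle, hD⟩

theorem volume_pi_update_const [DecidableEq ι] (j : ι) (U V : Set E) :
    volume (univ.pi (Function.update (fun _ => V) j U)) =
      volume U * volume V ^ (Fintype.card ι - 1) := by
  rw [volume_pi_pi, ← Finset.mul_prod_erase _ _ (Finset.mem_univ j), Function.update_self,
    Finset.prod_congr rfl fun i hi => by rw [Function.update_of_ne (Finset.ne_of_mem_erase hi)],
    Finset.prod_const, Finset.card_erase_of_mem (Finset.mem_univ j), Finset.card_univ]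

theorem volume_inter_pi_le_add_sum_diff (L : Set (ι → E)) {A B : ι → Set E} {V : Set E}
    (hA : ∀ j, A j ⊆ V) :
    volume (L ∩ univ.pi A) ≤ volume (L ∩ univ.pi B) +
      (∑ j, volume (A j \ B j)) * volume V ^ (Fintype.card ι - 1) := by
  classical
  have hcover : L ∩ univ.pi A ⊆
      (L ∩ univ.pi B) ∪ ⋃ j, univ.pi (Function.update (fun _ => V) j (A j \ B j)) := by
    rintro x ⟨hxL, hxA⟩
    by_cases hxB : ∀ j, x j ∈ B j
    · exact Or.inl ⟨hxL, fun j _ => hxB j⟩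
    · push Not at hxB
      obtain ⟨j, hj⟩ := hxB
      refine Or.inr (mem_iUnion.2 ⟨j, fun i _ => ?_⟩)
      rcases eq_or_ne i j with rfl | hij
      · simpa using ⟨hxA i trivial, hj⟩
      · simpa [hij] using hA i (hxA i trivial)
  calc volume (L ∩ univ.pi A)
      ≤ volume (L ∩ univ.pi B) +
        volume (⋃ j, univ.pi (Function.update (fun _ => V) j (A j \ B j))) :=
        (measure_mono hcover).trans (measure_union_le _ _)
    _ ≤ volume (L ∩ univ.pi B) +
        (∑ j, volume (A j \ B j)) * volume V ^ (Fintype.card ι - 1) := by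
        gcongr
        refine (measure_iUnion_fintype_le _ _).trans_eq ?_
        simp only [volume_pi_update_const, Finset.sum_mul]

theorem volume_inter_pi_le_pi_ball_of_subset_ball [Nontrivial E] {L : Set (ι → E)}
    (hL : MeasurableSet L) (hLc : IsSteinerConvex L) {A : ι → Set E}
    (hA : ∀ j, MeasurableSet (A j)) {R : ℝ} (hR : 0 < R) (hAR : ∀ j, A j ⊆ Metric.ball 0 R)
    {r : ι → ℝ} (hr : ∀ j, r j ≤ R)
    (hvol : ∀ j, volume (A j) ≤ volume (Metric.ball (0 : E) (r j))) :
    volume (L ∩ univ.pi A) ≤ volume (L ∩ univ.pi fun j => Metric.ball 0 (r j)) := by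
  set w := volume (Metric.ball (0 : E) R) ^ (Fintype.card ι - 1)
  have hw : w ≠ ∞ := ENNReal.pow_ne_top measure_ball_lt_top.ne
  refine ENNReal.le_of_forall_pos_le_add fun ε hε _ => ?_
  obtain ⟨A', hAR', hle, hD⟩ := exists_sum_volume_diff_ball_lt hL hLc hA hR hAR hr hvol
    (ENNReal.div_pos (ENNReal.coe_ne_zero.2 hε.ne') hw)
  calc volume (L ∩ univ.pi A) ≤ volume (L ∩ univ.pi A') := hle
    _ ≤ _ := volume_inter_pi_le_add_sum_diff L hAR'
    _ ≤ volume (L ∩ univ.pi fun j => Metric.ball 0 (r j)) + ε := by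
        gcongr
        exact ENNReal.mul_le_of_le_div hD.le

theorem volume_inter_pi_le_pi_ball [Nontrivial E] {L : Set (ι → E)} (hL : MeasurableSet L)
    (hLc : IsSteinerConvex L) {A : ι → Set E} (hA : ∀ j, MeasurableSet (A j)) {r : ι → ℝ}
    (hvol : ∀ j, volume (A j) ≤ volume (Metric.ball (0 : E) (r j))) :
    volume (L ∩ univ.pi A) ≤ volume (L ∩ univ.pi fun j => Metric.ball 0 (r j)) := by
  have hmono : Monotone fun N : ℕ => L ∩ univ.pi fun j => A j ∩ Metric.ball 0 N := by
    intro N N' h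
    refine inter_subset_inter_right _ (pi_mono fun j _ => inter_subset_inter_right _ ?_)
    exact Metric.ball_subset_ball (by exact_mod_cast h)
  rw [← iUnion_inter_pi_inter_ball, hmono.measure_iUnion]
  refine iSup_le fun N => ?_
  have hsum : 0 ≤ ∑ j, |r j| := Finset.sum_nonneg fun j _ => abs_nonneg (r j)
  refine volume_inter_pi_le_pi_ball_of_subset_ball (R := N + 1 + ∑ j, |r j|) hL hLc
    (fun j => (hA j).inter measurableSet_ball) (by positivity) (fun j => ?_) (fun j => ?_)
    fun j => (measure_mono inter_subset_left).trans (hvol j)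
  · exact inter_subset_right.trans (Metric.ball_subset_ball (by linarith))
  · have hj := Finset.single_le_sum (fun i _ => abs_nonneg (r i)) (Finset.mem_univ j)
    linarith [le_abs_self (r j), N.cast_nonneg (α := ℝ)]

theorem volume_inter_pi_le_symmRearrangement {n : ℕ} (hn : 1 ≤ n)
    {L : Set (ι → EuclideanSpace ℝ (Fin n))} (hL : MeasurableSet L) (hLc : IsSteinerConvex L)
    {A : ι → Set (EuclideanSpace ℝ (Fin n))} (hA : ∀ j, MeasurableSet (A j))
    (hfin : ∀ j, volume (A j) ≠ ∞) :
    volume (L ∩ univ.pi A) ≤ volume (L ∩ univ.pi fun j => symmRearrangement (A j)) := by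
  have : Nonempty (Fin n) := ⟨⟨0, hn⟩⟩
  exact volume_inter_pi_le_pi_ball hL hLc hA fun j => (volume_symmRearrangement hn _ (hfin j)).ge

end RearrangementInequality

section ProjectionVolume

open scoped Pointwise

variable {E : Type*} [NormedAddCommGroup E] [InnerProductSpace ℝ E]

theorem edist_le_volume_of_convex {I : Set ℝ} (hI : Convex ℝ I) {a b : ℝ} (ha : a ∈ I)
    (hb : b ∈ I) : edist a b ≤ volume I := by
  rw [edist_comm, edist_dist, Real.dist_eq, ← Real.volume_interval]
  exact measure_mono (hI.ordConnected.uIcc_subset ha hb)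

theorem volume_add_Icc {I : Set ℝ} (hI : IsCompact I) (hIc : Convex ℝ I) (hne : I.Nonempty)
    {c : ℝ} (hc : 0 ≤ c) : volume (I + Icc 0 c) = volume I + ENNReal.ofReal c := by
  obtain ⟨a, b, hab, rfl⟩ : ∃ a b : ℝ, a ≤ b ∧ I = Icc a b :=
    ⟨sInf I, sSup I, csInf_le hI.bddBelow (hI.sSup_mem hne),
      eq_Icc_of_connected_compact ⟨hne, hIc.isPreconnected⟩ hI⟩
  have hsum : Icc a b + Icc 0 c = Icc a (b + c) := by
    refine Subset.antisymm (by simpa using Icc_add_Icc_subset a b 0 c) fun t ht => ?_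
    refine mem_add.2 ⟨min t b, ⟨le_min ht.1 hab, min_le_right _ _⟩, t - min t b, ⟨?_, ?_⟩, by ring⟩
    · linarith [min_le_left t b]
    · rcases min_cases t b with h | h <;> linarith [ht.2]
  rw [hsum, Real.volume_Icc, Real.volume_Icc, ← ENNReal.ofReal_add (by linarith) hc]
  congr 1
  ring

theorem lineFiber_add_image_smul (θ : E) (K : Set E) (T : Set ℝ) (y : E) :
    lineFiber θ (K + (· • θ) '' T) y = lineFiber θ K y + T := by
  ext t
  constructor
  · rintro ⟨p, hp, _, ⟨s, hs, rfl⟩, h⟩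
    refine ⟨t - s, ?_, s, hs, sub_add_cancel t s⟩
    change y + (t - s) • θ ∈ K
    rwa [sub_smul, ← add_sub_assoc, ← h, add_sub_cancel_right]
  · rintro ⟨a, ha, s, hs, rfl⟩
    exact ⟨y + a • θ, ha, s • θ, mem_image_of_mem _ hs, by simp only [add_smul, add_assoc]⟩

theorem convex_lineFiber {K : Set E} (hK : Convex ℝ K) (θ y : E) : Convex ℝ (lineFiber θ K y) :=
  (hK.translate_preimage_right y).linear_preimage (LinearMap.toSpanSingleton ℝ E θ)

theorem isCompact_lineFiber {θ : E} (hθ : ‖θ‖ = 1) {K : Set E} (hK : IsCompact K) (y : E) :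
    IsCompact (lineFiber θ K y) := by
  have hiso : Isometry fun t : ℝ => y + t • θ :=
    (isometry_add_left y).comp (LinearIsometry.toSpanSingleton ℝ E hθ).isometry
  exact hiso.isClosedEmbedding.isCompact_preimage hK

theorem lineFiber_nonempty_iff {θ : E} (K : Set E) (y : (Submodule.span ℝ {θ})ᗮ) :
    (lineFiber θ K y).Nonempty ↔ y ∈ (Submodule.span ℝ {θ})ᗮ.orthogonalProjectionOnto '' K := by
  constructor
  · rintro ⟨t, ht⟩
    refine ⟨_, ht, ?_⟩
    have hθ : (Submodule.span ℝ {θ})ᗮ.orthogonalProjectionOnto θ = 0 := by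
      rw [Submodule.orthogonalProjectionOnto_eq_zero_iff]
      exact Submodule.le_orthogonal_orthogonal _ (Submodule.mem_span_singleton_self θ)
    rw [map_add, map_smul, hθ, smul_zero, add_zero,
      Submodule.orthogonalProjectionOnto_mem_subspace_eq_self]
  · rintro ⟨p, hp, rfl⟩
    have hmem : p - (Submodule.span ℝ {θ})ᗮ.orthogonalProjectionOnto p ∈
        Submodule.span ℝ {θ} :=
      (Submodule.span ℝ {θ}).orthogonal_orthogonal.le
        (Submodule.sub_starProjection_mem_orthogonal p)
    obtain ⟨t, ht⟩ := Submodule.mem_span_singleton.1 hmem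
    refine ⟨t, ?_⟩
    change _ + t • θ ∈ K
    rwa [ht, add_sub_cancel]

variable [FiniteDimensional ℝ E] [MeasurableSpace E] [BorelSpace E]

theorem volume_add_image_smul_Icc_of_norm_eq_one {θ : E} (hθ : ‖θ‖ = 1) {K : Set E}
    (hK : IsCompact K) (hKc : Convex ℝ K) {c : ℝ} (hc : 0 ≤ c) :
    volume (K + (· • θ) '' Icc 0 c) = volume K +
      ENNReal.ofReal c * volume ((Submodule.span ℝ {θ})ᗮ.orthogonalProjectionOnto '' K) := by
  set P := (Submodule.span ℝ {θ})ᗮ.orthogonalProjectionOnto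
  have hfiber (y : (Submodule.span ℝ {θ})ᗮ) : volume (lineFiber θ (K + (· • θ) '' Icc 0 c) y) =
      volume (lineFiber θ K y) + (P '' K).indicator (fun _ => ENNReal.ofReal c) y := by
    rw [lineFiber_add_image_smul]
    rcases (lineFiber θ K y).eq_empty_or_nonempty with h | h
    · rw [h, empty_add, measure_empty, indicator_of_notMem, add_zero]
      rw [← lineFiber_nonempty_iff, h]
      exact not_nonempty_empty
    · rw [volume_add_Icc (isCompact_lineFiber hθ hK y) (convex_lineFiber hKc θ y) h hc,
        indicator_of_mem ((lineFiber_nonempty_iff K y).1 h)]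
  have hsum : IsCompact (K + (· • θ) '' Icc 0 c) :=
    hK.add (isCompact_Icc.image (by fun_prop))
  rw [volume_eq_lintegral_lineFiber hθ hsum.measurableSet,
    volume_eq_lintegral_lineFiber hθ hK.measurableSet, lintegral_congr hfiber,
    lintegral_add_left
      (by exact (measurable_volume_lineFiber hK.measurableSet θ).comp measurable_subtype_coe),
    lintegral_indicator_const (hK.image P.continuous).measurableSet]

theorem volume_add_image_smul_Icc {n : ℕ} {K : Set (EuclideanSpace ℝ (Fin n))}
    (hK : IsCompact K) (hKc : Convex ℝ K) (u : EuclideanSpace ℝ (Fin n)) {N : ℝ} (hN : 0 ≤ N) :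
    volume (K + (· • u) '' Icc 0 N) =
      volume K + ENNReal.ofReal N * projectionBodySupport K u := by
  rcases eq_or_ne u 0 with rfl | hu
  · simp [projectionBodySupport, (nonempty_Icc.2 hN).image_const]
  have hu0 : 0 < ‖u‖ := norm_pos_iff.2 hu
  set θ : EuclideanSpace ℝ (Fin n) := ‖u‖⁻¹ • u
  have hθ : ‖θ‖ = 1 := norm_smul_inv_norm hu
  have huθ : u = ‖u‖ • θ := (smul_inv_smul₀ hu0.ne' u).symm
  have hspan : Submodule.span ℝ {θ} = Submodule.span ℝ {u} :=
    Submodule.span_singleton_smul_eq (inv_ne_zero hu0.ne').isUnit u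
  have himage : (· • u) '' Icc 0 N = (· • θ) '' Icc 0 (N * ‖u‖) := by
    have hIcc := image_mul_right_Icc hN hu0.le
    rw [zero_mul] at hIcc
    rw [← hIcc, image_image]
    simp only [mul_smul, ← huθ]
  rw [himage, volume_add_image_smul_Icc_of_norm_eq_one hθ hK hKc
    (by positivity), ENNReal.ofReal_mul hN, mul_assoc]
  rw! [hspan]
  rfl

end ProjectionVolume

section ShadowSystems

theorem volume_image_smul_add_smul_le {F : Type*} [AddCommGroup F] [Module ℝ F] {G : Set F}
    (hG : Convex ℝ G) (f g : F →ₗ[ℝ] ℝ) {a b : ℝ} (ha : 0 ≤ a) (hb : 0 ≤ b) :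
    volume ((a • f + b • g) '' G) ≤
      ENNReal.ofReal a * volume (f '' G) + ENNReal.ofReal b * volume (g '' G) := by
  refine (Real.volume_le_diam _).trans (Metric.ediam_le ?_)
  rintro _ ⟨x, hx, rfl⟩ _ ⟨y, hy, rfl⟩
  have hwidth (h : F →ₗ[ℝ] ℝ) : edist (h x) (h y) ≤ volume (h '' G) :=
    edist_le_volume_of_convex (hG.linear_image h) (mem_image_of_mem h hx) (mem_image_of_mem h hy)
  have hscale {c : ℝ} (hc : 0 ≤ c) (p q : ℝ) :
      edist (c • p) (c • q) = ENNReal.ofReal c * edist p q := by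
    rw [edist_smul₀, ← Real.toNNReal_eq_nnnorm_of_nonneg hc]
    rfl
  calc edist ((a • f + b • g) x) ((a • f + b • g) y)
      ≤ edist (a • f x) (a • f y) + edist (b • g x) (b • g y) := edist_add_add_le _ _ _ _
    _ = ENNReal.ofReal a * edist (f x) (f y) + ENNReal.ofReal b * edist (g x) (g y) := by
        rw [hscale ha, hscale hb]
    _ ≤ _ := by
        gcongr
        exacts [hwidth f, hwidth g]

variable {E ι : Type*} [Fintype ι] [NormedAddCommGroup E]

theorem isCompact_image_linearCombination [NormedSpace ℝ E] {D : Set (ι → ℝ)} (hD : IsCompact D)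
    (z : ι → E) : IsCompact (Fintype.linearCombination ℝ z '' D) :=
  hD.image (LinearMap.continuous_of_finiteDimensional _)

theorem isClosed_setOf_mem_image_linearCombination [NormedSpace ℝ E] {D : Set (ι → ℝ)}
    (hD : IsCompact D) :
    IsClosed {q : (ι → E) × E | q.2 ∈ Fintype.linearCombination ℝ q.1 '' D} := by
  have : CompactSpace D := isCompact_iff_compactSpace.1 hD
  have hproj : {q : (ι → E) × E | q.2 ∈ Fintype.linearCombination ℝ q.1 '' D} =
      Prod.fst '' {p : ((ι → E) × E) × D | ∑ j, (p.2 : ι → ℝ) j • p.1.1 j = p.1.2} := by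
    ext q
    simp [Fintype.linearCombination_apply]
  rw [hproj]
  refine isClosedMap_fst_of_compactSpace _ (isClosed_eq (continuous_finsetSum _ fun j _ => ?_)
    (by fun_prop))
  exact ((continuous_apply j).comp (continuous_subtype_val.comp continuous_snd)).smul
    ((continuous_apply j).comp (continuous_fst.comp continuous_fst))

variable [InnerProductSpace ℝ E]

theorem lineFiber_image_linearCombination (D : Set (ι → ℝ)) {θ : E} (hθ : ‖θ‖ = 1) {y : ι → E}
    (hy : ∀ j, inner ℝ θ (y j) = 0) (t : ι → ℝ) {w : E} (hw : inner ℝ θ w = 0) :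
    lineFiber θ (Fintype.linearCombination ℝ (fun j => y j + t j • θ) '' D) w =
      Fintype.linearCombination ℝ t '' (D ∩ Fintype.linearCombination ℝ y ⁻¹' {w}) := by
  have hsum (d : ι → ℝ) : Fintype.linearCombination ℝ (fun j => y j + t j • θ) d =
      Fintype.linearCombination ℝ y d + Fintype.linearCombination ℝ t d • θ := by
    simp only [Fintype.linearCombination_apply, smul_add, Finset.sum_add_distrib, Finset.sum_smul,
      smul_assoc]
  ext s
  constructor
  · rintro ⟨d, hd, h⟩
    have hyd : inner ℝ θ (Fintype.linearCombination ℝ y d) = 0 := by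
      simp [Fintype.linearCombination_apply, inner_sum, inner_smul_right, hy]
    have hs : Fintype.linearCombination ℝ t d = s := by
      have := congrArg (inner ℝ θ) (hsum d ▸ h)
      simpa [inner_add_right, inner_smul_right, hw, hyd, hθ] using this
    rw [hsum, hs] at h
    exact ⟨d, ⟨hd, add_right_cancel h⟩, hs⟩
  · rintro ⟨d, ⟨hd, rfl⟩, rfl⟩
    exact ⟨d, hd, hsum d⟩

variable [FiniteDimensional ℝ E] [MeasurableSpace E] [BorelSpace E]

theorem measurable_volume_image_linearCombination {D : Set (ι → ℝ)} (hD : IsCompact D) :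
    Measurable fun z : ι → E => volume (Fintype.linearCombination ℝ z '' D) :=
  measurable_measure_prodMk_left (isClosed_setOf_mem_image_linearCombination hD).measurableSet

theorem measurable_volume_image_linearCombination_fiber {D : Set (ι → ℝ)} (hD : IsCompact D)
    {θ : E} (hθ : ‖θ‖ = 1) {y : ι → E} (hy : ∀ j, inner ℝ θ (y j) = 0) (t : ι → ℝ) :
    Measurable fun w : (Submodule.span ℝ {θ})ᗮ => volume (Fintype.linearCombination ℝ t ''
      (D ∩ Fintype.linearCombination ℝ y ⁻¹' {(w : E)})) := by
  simp only [← lineFiber_image_linearCombination D hθ hy t (inner_coe_orthogonal_span θ _)]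
  exact (measurable_volume_lineFiber (isCompact_image_linearCombination hD _).measurableSet θ).comp
    measurable_subtype_coe

theorem volume_image_linearCombination_shadow {D : Set (ι → ℝ)} (hD : IsCompact D) {θ : E}
    (hθ : ‖θ‖ = 1) {y : ι → E} (hy : ∀ j, inner ℝ θ (y j) = 0) (t : ι → ℝ) :
    volume (Fintype.linearCombination ℝ (fun j => y j + t j • θ) '' D) =
      ∫⁻ w : (Submodule.span ℝ {θ})ᗮ, volume (Fintype.linearCombination ℝ t ''
        (D ∩ Fintype.linearCombination ℝ y ⁻¹' {(w : E)})) := by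
  rw [volume_eq_lintegral_lineFiber hθ (isCompact_image_linearCombination hD _).measurableSet]
  exact lintegral_congr fun w => by
    rw [lineFiber_image_linearCombination D hθ hy t (inner_coe_orthogonal_span θ w)]

/-- Along a shadow system `z_j(t) = y_j + t_j θ` the volume of `{∑ d_j z_j(t) : d ∈ D}` is a
convex function of `t`. -/
theorem volume_image_linearCombination_shadow_le {D : Set (ι → ℝ)} (hD : IsCompact D)
    (hDc : Convex ℝ D) {θ : E} (hθ : ‖θ‖ = 1) {y : ι → E} (hy : ∀ j, inner ℝ θ (y j) = 0)
    (t t' : ι → ℝ) {a b : ℝ} (ha : 0 ≤ a) (hb : 0 ≤ b) :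
    volume (Fintype.linearCombination ℝ (fun j => y j + (a • t + b • t') j • θ) '' D) ≤
      ENNReal.ofReal a * volume (Fintype.linearCombination ℝ (fun j => y j + t j • θ) '' D) +
      ENNReal.ofReal b * volume (Fintype.linearCombination ℝ (fun j => y j + t' j • θ) '' D) := by
  have hform : Fintype.linearCombination ℝ (a • t + b • t') =
      a • Fintype.linearCombination ℝ t + b • Fintype.linearCombination ℝ t' := by
    ext d
    simp [Fintype.linearCombination_apply, mul_add, mul_left_comm, Finset.sum_add_distrib,
      Finset.mul_sum]
  simp only [volume_image_linearCombination_shadow hD hθ hy, hform]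
  rw [← lintegral_const_mul' _ _ ENNReal.ofReal_ne_top,
    ← lintegral_const_mul' _ _ ENNReal.ofReal_ne_top,
    ← lintegral_add_left ((measurable_volume_image_linearCombination_fiber hD hθ hy t).const_mul _)]
  exact lintegral_mono fun w => volume_image_smul_add_smul_le
    (hDc.inter ((convex_singleton _).linear_preimage _)) _ _ ha hb

theorem volume_image_linearCombination_shadow_neg {D : Set (ι → ℝ)} (hD : IsCompact D) {θ : E}
    (hθ : ‖θ‖ = 1) {y : ι → E} (hy : ∀ j, inner ℝ θ (y j) = 0) (t : ι → ℝ) :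
    volume (Fintype.linearCombination ℝ (fun j => y j + (-t) j • θ) '' D) =
      volume (Fintype.linearCombination ℝ (fun j => y j + t j • θ) '' D) := by
  have hform : Fintype.linearCombination ℝ (-t) = -Fintype.linearCombination ℝ t :=
    (Fintype.bilinearCombination ℝ ℝ (α := ι) (M := ℝ)).map_neg t
  simp only [volume_image_linearCombination_shadow hD hθ hy, hform]
  refine lintegral_congr fun w => ?_
  rw [← Measure.measure_neg volume]
  congr 1
  ext s
  simp [neg_eq_iff_eq_neg]

end ShadowSystems

section PolarProjectionGraph

open scoped Pointwise

variable {n m : ℕ}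

theorem isCompact_matrixImage {C : Set (EuclideanSpace ℝ (Fin m))} (hC : IsCompact C)
    (x : Fin m → EuclideanSpace ℝ (Fin n)) : IsCompact (matrixImage x C) :=
  hC.image (by fun_prop)

theorem convex_matrixImage {C : Set (EuclideanSpace ℝ (Fin m))} (hC : Convex ℝ C)
    (x : Fin m → EuclideanSpace ℝ (Fin n)) : Convex ℝ (matrixImage x C) :=
  hC.linear_image (Fintype.linearCombination ℝ x ∘ₗ
    (WithLp.linearEquiv 2 ℝ (Fin m → ℝ)).toLinearMap)

/-- The cylinder `[0, N] × C`, as a set of coefficients for the columns `u, x₁, …, x_m`: it turns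
`[x₁ … x_m] C + [0, N] u` into a single linear image, to which the convexity of the volume along
shadow systems applies. -/
def segmentProd (C : Set (EuclideanSpace ℝ (Fin m))) (N : ℝ) : Set (Fin (m + 1) → ℝ) :=
  {d | d 0 ∈ Icc 0 N ∧ WithLp.toLp 2 (Fin.tail d) ∈ C}

theorem segmentProd_eq_image (C : Set (EuclideanSpace ℝ (Fin m))) (N : ℝ) :
    segmentProd C N = (fun p : ℝ × EuclideanSpace ℝ (Fin m) =>
      (Fin.cons p.1 (WithLp.ofLp p.2) : Fin (m + 1) → ℝ)) '' (Icc 0 N ×ˢ C) := by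
  ext d
  constructor
  · rintro ⟨h0, h1⟩
    exact ⟨(d 0, WithLp.toLp 2 (Fin.tail d)), ⟨h0, h1⟩, Fin.cons_self_tail d⟩
  · rintro ⟨⟨s, c⟩, ⟨hs, hc⟩, rfl⟩
    exact ⟨by simpa using hs, by simpa using hc⟩

theorem isCompact_segmentProd {C : Set (EuclideanSpace ℝ (Fin m))} (hC : IsCompact C) (N : ℝ) :
    IsCompact (segmentProd C N) := by
  rw [segmentProd_eq_image]
  refine (isCompact_Icc.prod hC).image (continuous_pi fun i => Fin.cases ?_ (fun i => ?_) i)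
  · exact continuous_fst
  · simp only [Fin.cons_succ]
    fun_prop

theorem convex_segmentProd {C : Set (EuclideanSpace ℝ (Fin m))} (hC : Convex ℝ C) (N : ℝ) :
    Convex ℝ (segmentProd C N) :=
  fun _ hd _ hd' _ _ ha hb hab =>
    ⟨convex_Icc (0 : ℝ) N hd.1 hd'.1 ha hb hab, hC hd.2 hd'.2 ha hb hab⟩

theorem image_linearCombination_segmentProd (C : Set (EuclideanSpace ℝ (Fin m))) (N : ℝ)
    (z : Fin (m + 1) → EuclideanSpace ℝ (Fin n)) :
    Fintype.linearCombination ℝ z '' segmentProd C N =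
      matrixImage (Fin.tail z) C + (· • z 0) '' Icc 0 N := by
  rw [segmentProd_eq_image, image_image, add_comm (matrixImage _ _), ← image2_add, matrixImage,
    image2_image_left, image2_image_right, ← image_prod]
  exact image_congr fun p _ => by
    simp [Fintype.linearCombination_apply, Fin.sum_univ_succ, Fin.tail]

theorem volume_image_linearCombination_segmentProd {C : Set (EuclideanSpace ℝ (Fin m))}
    (hC : IsCompact C) (hCc : Convex ℝ C) {N : ℝ} (hN : 0 ≤ N)
    (z : Fin (m + 1) → EuclideanSpace ℝ (Fin n)) :
    volume (Fintype.linearCombination ℝ z '' segmentProd C N) =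
      volume (matrixImage (Fin.tail z) C) +
        ENNReal.ofReal N * projectionBodySupport (matrixImage (Fin.tail z) C) (z 0) := by
  rw [image_linearCombination_segmentProd,
    volume_add_image_smul_Icc (isCompact_matrixImage hC _) (convex_matrixImage hCc _) _ hN]

/-- The pairs `(u, x₁, …, x_m)` with `u ∈ Π°([x₁ … x_m] C)`. -/
def polarProjectionGraph (n : ℕ) (C : Set (EuclideanSpace ℝ (Fin m))) :
    Set (Fin (m + 1) → EuclideanSpace ℝ (Fin n)) :=
  {z | z 0 ∈ polarProjectionBody (matrixImage (Fin.tail z) C)}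

theorem cons_mem_polarProjectionGraph_iff {C : Set (EuclideanSpace ℝ (Fin m))}
    {u : EuclideanSpace ℝ (Fin n)} {x : Fin m → EuclideanSpace ℝ (Fin n)} :
    (Fin.cons u x : Fin (m + 1) → EuclideanSpace ℝ (Fin n)) ∈ polarProjectionGraph n C ↔
      u ∈ polarProjectionBody (matrixImage x C) :=
  Iff.rfl

theorem measurableSet_polarProjectionGraph {C : Set (EuclideanSpace ℝ (Fin m))}
    (hC : IsCompact C) (hCc : Convex ℝ C) : MeasurableSet (polarProjectionGraph n C) := by
  have hgraph : polarProjectionGraph n C =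
      {z | volume (Fintype.linearCombination ℝ z '' segmentProd C 1) ≤
        volume (Fintype.linearCombination ℝ z '' segmentProd C 0) + 1} := by
    ext z
    rw [mem_ofPred_eq, volume_image_linearCombination_segmentProd hC hCc zero_le_one,
      volume_image_linearCombination_segmentProd hC hCc le_rfl, ENNReal.ofReal_one, one_mul,
      ENNReal.ofReal_zero, zero_mul, add_zero,
      ENNReal.add_le_add_iff_left (isCompact_matrixImage hC _).measure_ne_top]
    rfl
  rw [hgraph]
  exact measurableSet_le (measurable_volume_image_linearCombination (isCompact_segmentProd hC 1))
    ((measurable_volume_image_linearCombination (isCompact_segmentProd hC 0)).add_const 1)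

theorem le_of_forall_natCast_mul_le {c s t : ℝ≥0∞} (hc : c ≠ ∞)
    (h : ∀ N : ℕ, N * s ≤ c + N * t) : s ≤ t := by
  have hlim : Filter.Tendsto (fun N : ℕ => (N : ℝ≥0∞)⁻¹ * c + t) Filter.atTop
      (nhds (0 * c + t)) :=
    (ENNReal.Tendsto.mul_const ENNReal.tendsto_inv_nat_nhds_zero (Or.inr hc)).add_const t
  rw [zero_mul, zero_add] at hlim
  refine ge_of_tendsto hlim (Filter.eventually_atTop.2 ⟨1, fun N hN => ?_⟩)
  have hcancel : (N : ℝ≥0∞)⁻¹ * N = 1 :=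
    ENNReal.inv_mul_cancel (by exact_mod_cast (by omega : N ≠ 0)) (ENNReal.natCast_ne_top N)
  calc s = (N : ℝ≥0∞)⁻¹ * (N * s) := by rw [← mul_assoc, hcancel, one_mul]
    _ ≤ (N : ℝ≥0∞)⁻¹ * (c + N * t) := by gcongr; exact h N
    _ = (N : ℝ≥0∞)⁻¹ * c + t := by rw [mul_add, ← mul_assoc, hcancel, one_mul]

-- The volume of `K + [0, N] u` is `|K| + N h_{ΠK}(u)`, and it is convex and even along a shadow
-- system; both properties pass to `h_{ΠK}(u)` on dividing by `N → ∞`.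
theorem projectionBodySupport_shadow_le {C : Set (EuclideanSpace ℝ (Fin m))} (hC : IsCompact C)
    (hCc : Convex ℝ C) {θ : EuclideanSpace ℝ (Fin n)} (hθ : ‖θ‖ = 1)
    {y : Fin (m + 1) → EuclideanSpace ℝ (Fin n)} (hy : ∀ j, inner ℝ θ (y j) = 0)
    (t t' : Fin (m + 1) → ℝ) {a b : ℝ} (ha : 0 ≤ a) (hb : 0 ≤ b) :
    projectionBodySupport (matrixImage (Fin.tail fun j => y j + (a • t + b • t') j • θ) C)
        (y 0 + (a • t + b • t') 0 • θ) ≤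
      ENNReal.ofReal a * projectionBodySupport (matrixImage (Fin.tail fun j => y j + t j • θ) C)
          (y 0 + t 0 • θ) +
        ENNReal.ofReal b * projectionBodySupport (matrixImage (Fin.tail fun j => y j + t' j • θ) C)
          (y 0 + t' 0 • θ) := by
  have hscaled (c : ℝ) (s : Fin (m + 1) → ℝ) :
      ENNReal.ofReal c * volume (matrixImage (Fin.tail fun j => y j + s j • θ) C) ≠ ∞ :=
    ENNReal.mul_ne_top ENNReal.ofReal_ne_top (isCompact_matrixImage hC _).measure_ne_top
  refine le_of_forall_natCast_mul_le (ENNReal.add_ne_top.2 ⟨hscaled a t, hscaled b t'⟩) fun N => ?_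
  have hconv := volume_image_linearCombination_shadow_le (isCompact_segmentProd hC (N : ℝ))
    (convex_segmentProd hCc (N : ℝ)) hθ hy t t' ha hb
  simp only [volume_image_linearCombination_segmentProd hC hCc (Nat.cast_nonneg N),
    ENNReal.ofReal_natCast] at hconv
  exact (le_add_self.trans hconv).trans_eq (by ring)

theorem projectionBodySupport_shadow_neg {C : Set (EuclideanSpace ℝ (Fin m))} (hC : IsCompact C)
    (hCc : Convex ℝ C) {θ : EuclideanSpace ℝ (Fin n)} (hθ : ‖θ‖ = 1)
    {y : Fin (m + 1) → EuclideanSpace ℝ (Fin n)} (hy : ∀ j, inner ℝ θ (y j) = 0)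
    (t : Fin (m + 1) → ℝ) :
    projectionBodySupport (matrixImage (Fin.tail fun j => y j + (-t) j • θ) C)
        (y 0 + (-t) 0 • θ) =
      projectionBodySupport (matrixImage (Fin.tail fun j => y j + t j • θ) C) (y 0 + t 0 • θ) := by
  have heven (N : ℝ) :=
    volume_image_linearCombination_shadow_neg (isCompact_segmentProd hC N) hθ hy t
  have h0 := heven 0
  have h1 := heven 1
  simp only [volume_image_linearCombination_segmentProd hC hCc le_rfl,
    volume_image_linearCombination_segmentProd hC hCc zero_le_one, ENNReal.ofReal_zero,
    ENNReal.ofReal_one, zero_mul, one_mul, add_zero] at h0 h1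
  rwa [h0, ENNReal.add_right_inj (isCompact_matrixImage hC _).measure_ne_top] at h1

theorem isSteinerConvex_polarProjectionGraph {C : Set (EuclideanSpace ℝ (Fin m))}
    (hC : IsCompact C) (hCc : Convex ℝ C) : IsSteinerConvex (polarProjectionGraph n C) := by
  refine fun θ hθ y hy => ⟨fun t ht t' ht' a b ha hb hab => ?_, fun t ht => ?_⟩
  · calc _ ≤ _ := projectionBodySupport_shadow_le hC hCc hθ hy t t' ha hb
      _ ≤ ENNReal.ofReal a * 1 + ENNReal.ofReal b * 1 := by gcongr <;> assumption
      _ = 1 := by rw [mul_one, mul_one, ← ENNReal.ofReal_add ha hb, hab, ENNReal.ofReal_one]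
  · exact (projectionBodySupport_shadow_neg hC hCc hθ hy t).trans_le ht

end PolarProjectionGraph

section Layers

variable {α β ι : Type*} [MeasurableSpace α] [MeasurableSpace β] {μ : Measure α} {τ : Measure β}

theorem map_fst_restrict_prod [SFinite μ] [SFinite τ] {T : Set (α × β)} (hT : MeasurableSet T) :
    ((μ.prod τ).restrict T).map Prod.fst = μ.withDensity fun x => τ (Prod.mk x ⁻¹' T) := by
  ext s hs
  rw [Measure.map_apply measurable_fst hs, Measure.restrict_apply (measurable_fst hs),
    Measure.prod_apply ((measurable_fst hs).inter hT), withDensity_apply _ hs,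
    ← lintegral_indicator hs]
  refine lintegral_congr fun x => ?_
  by_cases hx : x ∈ s <;> simp [hx, preimage_preimage]

/-- A density of the form `x ↦ τ {t | (x, t) ∈ T}` is a superposition of the layers
`{x | (x, t) ∈ T}`; for a product of such densities the layers are boxes. -/
theorem pi_withDensity_measure_section [Fintype ι] [SigmaFinite μ] [SigmaFinite τ]
    {T : ι → Set (α × β)} (hT : ∀ j, MeasurableSet (T j))
    [∀ j, SigmaFinite (μ.withDensity fun x => τ (Prod.mk x ⁻¹' T j))] {L : Set (ι → α)}
    (hL : MeasurableSet L) :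
    Measure.pi (fun j => μ.withDensity fun x => τ (Prod.mk x ⁻¹' T j)) L =
      ∫⁻ t, Measure.pi (fun _ => μ) (L ∩ univ.pi fun j => (·, t j) ⁻¹' T j)
        ∂Measure.pi fun _ => τ := by
  have hσ (j : ι) : SigmaFinite (((μ.prod τ).restrict (T j)).map Prod.fst) := by
    rw [map_fst_restrict_prod (hT j)]
    infer_instance
  have hfst : Measurable fun (p : ι → α × β) j => (p j).1 := by fun_prop
  have hpair : Measurable fun (q : (ι → α) × (ι → β)) j => (q.1 j, q.2 j) := by fun_prop
  have hTL : MeasurableSet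
      {q : (ι → α) × (ι → β) | q.1 ∈ L ∧ (fun j => (q.1 j, q.2 j)) ∈ univ.pi T} :=
    (measurable_fst hL).inter (hpair (.univ_pi hT))
  simp only [← map_fst_restrict_prod (hT _)]
  rw [← Measure.pi_map_pi fun j => measurable_fst.aemeasurable, Measure.map_apply hfst hL,
    ← Measure.restrict_pi_pi, Measure.restrict_apply (hfst hL)]
  refine ((measurePreserving_arrowProdEquivProdArrow α β ι (fun _ => μ)
    fun _ => τ).measure_preimage hTL.nullMeasurableSet).trans ?_
  rw [Measure.prod_apply_symm hTL]
  refine lintegral_congr fun t => congrArg _ ?_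
  ext x
  simp

end Layers

section Rearrangement

variable {n : ℕ}

theorem symmRearrangement_congr {A A' : Set (EuclideanSpace ℝ (Fin n))}
    (h : volume A = volume A') : symmRearrangement A = symmRearrangement A' := by
  simp only [symmRearrangement, Measure.real, h]

theorem symmRearrangement_empty (hn : 1 ≤ n) :
    symmRearrangement (∅ : Set (EuclideanSpace ℝ (Fin n))) = ∅ := by
  have hpow : 1 / (n : ℝ) ≠ 0 := one_div_ne_zero (by exact_mod_cast (by omega : n ≠ 0))
  rw [symmRearrangement, measureReal_empty, zero_div, Real.zero_rpow hpow, Metric.ball_zero]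

theorem symmRearrangement_ball (hn : 1 ≤ n) (r : ℝ) :
    symmRearrangement (Metric.ball (0 : EuclideanSpace ℝ (Fin n)) r) = Metric.ball 0 r := by
  rcases le_total r 0 with hr | hr
  · rw [Metric.ball_eq_empty.2 hr, symmRearrangement_empty hn]
  · have : Nonempty (Fin n) := ⟨⟨0, hn⟩⟩
    have hB : 0 < volume.real (Metric.ball (0 : EuclideanSpace ℝ (Fin n)) 1) :=
      ENNReal.toReal_pos (Metric.measure_ball_pos _ _ one_pos).ne' measure_ball_lt_top.ne
    have hr' : volume.real (Metric.ball (0 : EuclideanSpace ℝ (Fin n)) r) =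
        r ^ n * volume.real (Metric.ball (0 : EuclideanSpace ℝ (Fin n)) 1) := by
      rw [Measure.real, Measure.addHaar_ball _ _ hr, ENNReal.toReal_mul,
        ENNReal.toReal_ofReal (by positivity), finrank_euclideanSpace_fin, ← Measure.real]
    rw [symmRearrangement, hr', mul_div_cancel_right₀ _ hB.ne', one_div,
      Real.pow_rpow_inv_natCast hr (by omega)]

theorem symmDecrRearrangement_congr_ae {f g : EuclideanSpace ℝ (Fin n) → ℝ}
    (h : f =ᵐ[volume] g) : symmDecrRearrangement f = symmDecrRearrangement g := by
  have hlevel (t : ℝ) : symmRearrangement {y | t < f y} = symmRearrangement {y | t < g y} :=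
    symmRearrangement_congr (measure_congr (h.mono fun y hy => by
      change (t < f y) = (t < g y)
      rw [hy]))
  ext x
  simp only [symmDecrRearrangement, hlevel]

theorem symmDecrRearrangement_indicator (hn : 1 ≤ n) (A : Set (EuclideanSpace ℝ (Fin n)))
    (a : ℝ) : symmDecrRearrangement (A.indicator fun _ => a) =
      (symmRearrangement A).indicator fun _ => ENNReal.ofReal a := by
  have hlevel {t : ℝ} (ht : t ∈ Ioi 0) :
      {y | t < A.indicator (fun _ => a) y} = if t < a then A else ∅ := by
    ext y
    by_cases hy : y ∈ A <;> by_cases hta : t < a <;> simp [hy, hta, le_of_lt ht.out]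
  have hlayer {t : ℝ} (ht : t ∈ Ioi 0) (x : EuclideanSpace ℝ (Fin n)) :
      (symmRearrangement {y | t < A.indicator (fun _ => a) y}).indicator
          (fun _ => (1 : ℝ≥0∞)) x =
        (Iio a).indicator (fun _ => (symmRearrangement A).indicator (fun _ => 1) x) t := by
    rw [hlevel ht]
    by_cases hta : t < a <;> simp [hta, symmRearrangement_empty hn]
  ext x
  rw [symmDecrRearrangement, setLIntegral_congr_fun measurableSet_Ioi fun t ht => hlayer ht x,
    lintegral_indicator_const measurableSet_Iio, Measure.restrict_apply measurableSet_Iio,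
    Iio_inter_Ioi, Real.volume_Ioo, sub_zero]
  by_cases hx : x ∈ symmRearrangement A <;> simp [hx]

theorem measurableSet_setOf_lt_comp_fst {f : EuclideanSpace ℝ (Fin n) → ℝ} (hf : Measurable f) :
    MeasurableSet {p : EuclideanSpace ℝ (Fin n) × ℝ | p.2 < f p.1} :=
  measurableSet_lt measurable_snd (hf.comp measurable_fst)

theorem measurableSet_setOf_mem_symmRearrangement {f : EuclideanSpace ℝ (Fin n) → ℝ}
    (hf : Measurable f) : MeasurableSet
      {p : EuclideanSpace ℝ (Fin n) × ℝ | p.1 ∈ symmRearrangement {y | p.2 < f y}} := by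
  have hvol : Measurable fun t : ℝ => volume.real {y | t < f y} :=
    (measurable_measure_prodMk_right (measurableSet_setOf_lt_comp_fst hf)).ennreal_toReal
  simp only [symmRearrangement, mem_ball_zero_iff]
  exact measurableSet_lt (by fun_prop) (((hvol.comp measurable_snd).div_const _).pow_const _)

theorem symmDecrRearrangement_eq_volume_restrict_section {f : EuclideanSpace ℝ (Fin n) → ℝ}
    (hf : Measurable f) (x : EuclideanSpace ℝ (Fin n)) :
    symmDecrRearrangement f x = volume.restrict (Ioi 0)
      (Prod.mk x ⁻¹' {p | p.1 ∈ symmRearrangement {y | p.2 < f y}}) := by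
  rw [← lintegral_indicator_one
    ((measurableSet_setOf_mem_symmRearrangement hf).preimage measurable_prodMk_left),
    symmDecrRearrangement]
  congr 1

theorem ofReal_eq_volume_restrict_section (f : EuclideanSpace ℝ (Fin n) → ℝ)
    (x : EuclideanSpace ℝ (Fin n)) :
    ENNReal.ofReal (f x) = volume.restrict (Ioi 0) (Prod.mk x ⁻¹' {p | p.2 < f p.1}) := by
  rw [show Prod.mk x ⁻¹' {p | p.2 < f p.1} = Iio (f x) from rfl,
    Measure.restrict_apply measurableSet_Iio, Iio_inter_Ioi, Real.volume_Ioo, sub_zero]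

theorem lintegral_symmDecrRearrangement (hn : 1 ≤ n) {f : EuclideanSpace ℝ (Fin n) → ℝ}
    (hf : Measurable f) (hfi : Integrable f) :
    ∫⁻ x, symmDecrRearrangement f x = ∫⁻ x, ENNReal.ofReal (f x) := by
  simp only [symmDecrRearrangement_eq_volume_restrict_section hf,
    ofReal_eq_volume_restrict_section]
  rw [← Measure.prod_apply (measurableSet_setOf_mem_symmRearrangement hf),
    ← Measure.prod_apply (measurableSet_setOf_lt_comp_fst hf),
    Measure.prod_apply_symm (measurableSet_setOf_mem_symmRearrangement hf),
    Measure.prod_apply_symm (measurableSet_setOf_lt_comp_fst hf)]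
  exact setLIntegral_congr_fun measurableSet_Ioi fun t ht =>
    volume_symmRearrangement hn _ (hfi.measure_gt_lt_top ht).ne

theorem isFiniteMeasure_withDensity_symmDecrRearrangement (hn : 1 ≤ n)
    {f : EuclideanSpace ℝ (Fin n) → ℝ} (hf : Measurable f) (hfi : Integrable f) :
    IsFiniteMeasure (volume.withDensity (symmDecrRearrangement f)) :=
  isFiniteMeasure_withDensity <| by
    rw [lintegral_symmDecrRearrangement hn hf hfi]
    exact hfi.lintegral_lt_top.ne

theorem pi_withDensity_le_symmDecrRearrangement {ι : Type*} [Fintype ι] (hn : 1 ≤ n)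
    {L : Set (ι → EuclideanSpace ℝ (Fin n))} (hL : MeasurableSet L) (hLc : IsSteinerConvex L)
    {f : ι → EuclideanSpace ℝ (Fin n) → ℝ} (hf : ∀ j, Measurable (f j))
    (hfi : ∀ j, Integrable (f j)) :
    Measure.pi (fun j => volume.withDensity fun x => ENNReal.ofReal (f j x)) L ≤
      Measure.pi (fun j => volume.withDensity (symmDecrRearrangement (f j))) L := by
  have hfin (j) : IsFiniteMeasure (volume.withDensity fun x => ENNReal.ofReal (f j x)) :=
    isFiniteMeasure_withDensity_ofReal (hfi j).2
  have hfin' (j) := isFiniteMeasure_withDensity_symmDecrRearrangement hn (hf j) (hfi j)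
  simp only [ofReal_eq_volume_restrict_section,
    funext (symmDecrRearrangement_eq_volume_restrict_section (hf _))] at hfin hfin' ⊢
  rw [pi_withDensity_measure_section (fun j => measurableSet_setOf_lt_comp_fst (hf j)) hL,
    pi_withDensity_measure_section
      (fun j => measurableSet_setOf_mem_symmRearrangement (hf j)) hL]
  have hpos : ∀ᵐ t ∂Measure.pi fun _ : ι => volume.restrict (Ioi (0 : ℝ)), ∀ j, 0 < t j :=
    ae_all_iff.2 fun j => (Measure.quasiMeasurePreserving_eval _ j).ae
      (ae_restrict_mem measurableSet_Ioi)
  refine lintegral_mono_ae (hpos.mono fun t ht => ?_)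
  exact volume_inter_pi_le_symmRearrangement hn hL hLc
    (fun j => measurableSet_lt measurable_const (hf j)) fun j =>
      ((hfi j).measure_gt_lt_top (ht j)).ne

end Rearrangement

section RadialWeights

theorem measure_eq_iSup_restrict_ball {E : Type*} [NormedAddCommGroup E] [MeasurableSpace E]
    [OpensMeasurableSpace E] (μ : Measure E) (s : Set E) :
    μ s = ⨆ k : ℕ, μ.restrict (Metric.ball 0 (k : ℝ)) s := by
  have hmono : Monotone fun k : ℕ => s ∩ Metric.ball (0 : E) k := fun a b hab =>
    inter_subset_inter_right _ (Metric.ball_subset_ball (by exact_mod_cast hab))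
  simp only [Measure.restrict_apply' measurableSet_ball]
  rw [← hmono.measure_iUnion, ← inter_iUnion, Metric.iUnion_ball_nat, inter_univ]

variable {E : Type*} [NormedAddCommGroup E] [NormedSpace ℝ E] [FiniteDimensional ℝ E]
  [Nontrivial E] [MeasurableSpace E] [BorelSpace E] (lam : Measure E) [lam.IsAddHaarMeasure]

theorem exists_ball_ae_eq_of_norm_lowerSet {S : Set E}
    (hS : ∀ ⦃u v⦄, ‖u‖ ≤ ‖v‖ → v ∈ S → u ∈ S) (hb : Bornology.IsBounded S) :
    ∃ R : ℝ, S =ᵐ[lam] Metric.ball 0 R := by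
  obtain ⟨M, hM⟩ := hb.exists_norm_le
  have hbdd : BddAbove (norm '' S) := ⟨M, forall_mem_image.2 hM⟩
  refine ⟨sSup (norm '' S), ?_⟩
  have hball : Metric.ball 0 (sSup (norm '' S)) ⊆ S := by
    intro u hu
    rcases S.eq_empty_or_nonempty with rfl | hne
    · simp at hu
    obtain ⟨_, ⟨v, hv, rfl⟩, huv⟩ := exists_lt_of_lt_csSup (hne.image _) (mem_ball_zero_iff.1 hu)
    exact hS huv.le hv
  have hclosed : S ⊆ Metric.closedBall 0 (sSup (norm '' S)) := fun u hu =>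
    mem_closedBall_zero_iff.2 (le_csSup hbdd (mem_image_of_mem _ hu))
  have hdiff : S \ Metric.ball 0 (sSup (norm '' S)) ⊆ Metric.sphere 0 (sSup (norm '' S)) := by
    rw [← Metric.closedBall_sdiff_ball]
    exact sdiff_subset_sdiff_left hclosed
  exact (ae_le_set.2 (measure_mono_null hdiff (Measure.addHaar_sphere lam _ _))).antisymm
    hball.eventuallyLE

variable {lam}

theorem measure_le_of_forall_ball_le {μ μ' : Measure E} (hμ : μ ≪ lam) (hμ' : μ' ≪ lam)
    (h : ∀ R, μ (Metric.ball 0 R) ≤ μ' (Metric.ball 0 R)) {S : Set E}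
    (hS : ∀ ⦃u v⦄, ‖u‖ ≤ ‖v‖ → v ∈ S → u ∈ S) : μ S ≤ μ' S := by
  rw [measure_eq_iSup_restrict_ball μ, measure_eq_iSup_restrict_ball μ']
  refine iSup_mono fun N => ?_
  rw [Measure.restrict_apply' measurableSet_ball, Measure.restrict_apply' measurableSet_ball]
  obtain ⟨R, hR⟩ := exists_ball_ae_eq_of_norm_lowerSet lam (S := S ∩ Metric.ball 0 N)
    (fun u v huv hv => ⟨hS huv hv.1,
      mem_ball_zero_iff.2 (huv.trans_lt (mem_ball_zero_iff.1 hv.2))⟩)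
    (Metric.isBounded_ball.subset inter_subset_right)
  rw [measure_congr (hμ.ae_le hR), measure_congr (hμ'.ae_le hR)]
  exact h R

theorem lintegral_antitone_norm_le_of_forall_ball_le {μ μ' : Measure E} [SFinite μ] [SFinite μ']
    (hμ : μ ≪ lam) (hμ' : μ' ≪ lam) (h : ∀ R, μ (Metric.ball 0 R) ≤ μ' (Metric.ball 0 R))
    {φ : ℝ → ℝ≥0∞} (hφ : Antitone φ) : ∫⁻ u, φ ‖u‖ ∂μ ≤ ∫⁻ u, φ ‖u‖ ∂μ' := by
  have hφm : Measurable fun u : E => φ ‖u‖ := hφ.measurable.comp measurable_norm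
  rw [lintegral_eq_lintegral_meas_ofReal_lt μ hφm, lintegral_eq_lintegral_meas_ofReal_lt μ' hφm]
  exact lintegral_mono fun t => measure_le_of_forall_ball_le hμ hμ' h
    fun u v huv (hv : _ < φ ‖v‖) => hv.trans_le (hφ huv)

end RadialWeights

section RandomColumns

variable {n m : ℕ} {C : Set (EuclideanSpace ℝ (Fin m))}

theorem IsRadialDecreasing.exists_antitone (hn : 1 ≤ n)
    {ν : Measure (EuclideanSpace ℝ (Fin n))} (hν : IsRadialDecreasing ν) :
    ∃ φ : ℝ → ℝ≥0∞, Antitone φ ∧ ν = volume.withDensity fun u => φ ‖u‖ := by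
  have : Nonempty (Fin n) := ⟨⟨0, hn⟩⟩
  obtain ⟨ρ, hρ, -, rfl⟩ := hν
  refine ⟨fun r => if r ≤ 0 then ∞ else ENNReal.ofReal (ρ r), fun r s hrs => ?_,
    withDensity_congr_ae ((Measure.ae_ne volume 0).mono fun u hu => ?_)⟩
  · by_cases hr : r ≤ 0
    · simp [hr]
    · have hs : ¬ s ≤ 0 := fun hs => hr (hrs.trans hs)
      simpa only [hr, hs, if_false] using
        ENNReal.ofReal_le_ofReal (hρ (not_le.1 hr) (not_le.1 hs) hrs)
  · simp [hu]

theorem measurableSet_setOf_mem_polarProjectionBody_matrixImage (hC : IsCompact C)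
    (hCc : Convex ℝ C) : MeasurableSet
      {p : EuclideanSpace ℝ (Fin n) × (Fin m → EuclideanSpace ℝ (Fin n)) |
        p.1 ∈ polarProjectionBody (matrixImage p.2 C)} := by
  simp only [← cons_mem_polarProjectionGraph_iff]
  exact measurable_finCons (measurableSet_polarProjectionGraph hC hCc)

theorem measurableSet_polarProjectionBody_matrixImage (hC : IsCompact C) (hCc : Convex ℝ C)
    (x : Fin m → EuclideanSpace ℝ (Fin n)) :
    MeasurableSet (polarProjectionBody (matrixImage x C)) :=
  measurable_prodMk_right (measurableSet_setOf_mem_polarProjectionBody_matrixImage hC hCc)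

theorem measurable_measure_polarProjectionBody (hC : IsCompact C) (hCc : Convex ℝ C)
    (ν : Measure (EuclideanSpace ℝ (Fin n))) [SFinite ν] :
    Measurable fun x : Fin m → EuclideanSpace ℝ (Fin n) =>
      ν (polarProjectionBody (matrixImage x C)) :=
  measurable_measure_prodMk_right (measurableSet_setOf_mem_polarProjectionBody_matrixImage hC hCc)

theorem measurable_measure_setOf_mem_polarProjectionBody (hC : IsCompact C) (hCc : Convex ℝ C)
    (κ : Measure (Fin m → EuclideanSpace ℝ (Fin n))) [SFinite κ] :
    Measurable fun u => κ {x | u ∈ polarProjectionBody (matrixImage x C)} :=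
  measurable_measure_prodMk_left (measurableSet_setOf_mem_polarProjectionBody_matrixImage hC hCc)

theorem lintegral_measure_polarProjectionBody (hC : IsCompact C) (hCc : Convex ℝ C)
    (ν : Measure (EuclideanSpace ℝ (Fin n))) [SFinite ν]
    (κ : Measure (Fin m → EuclideanSpace ℝ (Fin n))) [SFinite κ] :
    ∫⁻ x, ν (polarProjectionBody (matrixImage x C)) ∂κ =
      ∫⁻ u, κ {x | u ∈ polarProjectionBody (matrixImage x C)} ∂ν := by
  have hG := measurableSet_setOf_mem_polarProjectionBody_matrixImage (n := n) hC hCc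
  exact (Measure.prod_apply_symm hG).symm.trans (Measure.prod_apply hG)

theorem pi_polarProjectionGraph (hC : IsCompact C) (hCc : Convex ℝ C)
    (μ : Fin (m + 1) → Measure (EuclideanSpace ℝ (Fin n))) [∀ i, SigmaFinite (μ i)] :
    Measure.pi μ (polarProjectionGraph n C) = ∫⁻ u, Measure.pi (fun i => μ i.succ)
      {x | u ∈ polarProjectionBody (matrixImage x C)} ∂μ 0 := by
  have hG := measurableSet_polarProjectionGraph (n := n) hC hCc
  rw [← (measurePreserving_finCons μ).measure_preimage hG.nullMeasurableSet,
    Measure.prod_apply (hG.preimage measurable_finCons)]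
  rfl

theorem setLIntegral_ball_pi_le_symmDecrRearrangement (hn : 1 ≤ n) (hC : IsCompact C)
    (hCc : Convex ℝ C) {f : EuclideanSpace ℝ (Fin n) → ℝ} (hf : Measurable f)
    (hfi : Integrable f) (R : ℝ) :
    ∫⁻ u in Metric.ball 0 R, Measure.pi
        (fun _ : Fin m => volume.withDensity fun x => ENNReal.ofReal (f x))
        {x | u ∈ polarProjectionBody (matrixImage x C)} ≤
      ∫⁻ u in Metric.ball 0 R, Measure.pi
        (fun _ : Fin m => volume.withDensity (symmDecrRearrangement f))
        {x | u ∈ polarProjectionBody (matrixImage x C)} := by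
  let B : Set (EuclideanSpace ℝ (Fin n)) := Metric.ball 0 R
  let F : Fin (m + 1) → EuclideanSpace ℝ (Fin n) → ℝ :=
    Fin.cons (B.indicator fun _ => 1) fun _ => f
  have hF (j) : Measurable (F j) :=
    Fin.cases (measurable_const.indicator measurableSet_ball) (fun _ => hf) j
  have hFi (j) : Integrable (F j) :=
    Fin.cases ((integrable_indicator_iff measurableSet_ball).2
      (integrableOn_const measure_ball_lt_top.ne)) (fun _ => hfi) j
  have hB : (volume.withDensity fun x => ENNReal.ofReal (F 0 x)) = volume.restrict B := by
    have : (fun x => ENNReal.ofReal (F 0 x)) = B.indicator 1 := by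
      ext x
      by_cases hx : x ∈ B <;> simp [F, hx]
    rw [this, withDensity_indicator_one measurableSet_ball]
  have hB' : volume.withDensity (symmDecrRearrangement (F 0)) = volume.restrict B := by
    have : symmDecrRearrangement (F 0) = B.indicator 1 := by
      simp only [F, Fin.cons_zero, symmDecrRearrangement_indicator hn, B,
        symmRearrangement_ball hn, ENNReal.ofReal_one]
      rfl
    rw [this, withDensity_indicator_one measurableSet_ball]
  have (j : Fin (m + 1)) :
      IsFiniteMeasure (volume.withDensity fun x => ENNReal.ofReal (F j x)) :=
    isFiniteMeasure_withDensity_ofReal (hFi j).2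
  have (j : Fin (m + 1)) :=
    isFiniteMeasure_withDensity_symmDecrRearrangement hn (hF j) (hFi j)
  have h := pi_withDensity_le_symmDecrRearrangement hn
    (measurableSet_polarProjectionGraph hC hCc) (isSteinerConvex_polarProjectionGraph hC hCc)
    hF hFi
  rwa [pi_polarProjectionGraph hC hCc, pi_polarProjectionGraph hC hCc, hB, hB'] at h

theorem lintegral_pi_measure_polarProjectionBody_le (hn : 1 ≤ n) (hC : IsCompact C)
    (hCc : Convex ℝ C) {f : EuclideanSpace ℝ (Fin n) → ℝ} (hf : Integrable f)
    {ν : Measure (EuclideanSpace ℝ (Fin n))} (hν : IsRadialDecreasing ν) :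
    ∫⁻ x, ν (polarProjectionBody (matrixImage x C))
        ∂Measure.pi (fun _ : Fin m => volume.withDensity fun y => ENNReal.ofReal (f y)) ≤
      ∫⁻ x, ν (polarProjectionBody (matrixImage x C))
        ∂Measure.pi (fun _ : Fin m => volume.withDensity (symmDecrRearrangement f)) := by
  have : Nonempty (Fin n) := ⟨⟨0, hn⟩⟩
  obtain ⟨φ, hφ, rfl⟩ := hν.exists_antitone hn
  have hφm : Measurable fun u : EuclideanSpace ℝ (Fin n) => φ ‖u‖ :=
    hφ.measurable.comp measurable_norm
  have hlayers (κ : Measure (Fin m → EuclideanSpace ℝ (Fin n))) [SFinite κ] :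
      ∫⁻ x, volume.withDensity (fun u => φ ‖u‖) (polarProjectionBody (matrixImage x C)) ∂κ =
        ∫⁻ u, φ ‖u‖ ∂volume.withDensity fun u =>
          κ {x | u ∈ polarProjectionBody (matrixImage x C)} := by
    have hκ := measurable_measure_setOf_mem_polarProjectionBody (n := n) hC hCc κ
    rw [lintegral_measure_polarProjectionBody hC hCc,
      lintegral_withDensity_eq_lintegral_mul _ hφm hκ,
      lintegral_withDensity_eq_lintegral_mul _ hκ hφm, mul_comm]
  have hf0 : AEMeasurable f := hf.1.aemeasurable
  have hf1 : Integrable (hf0.mk f) := hf.congr hf0.ae_eq_mk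
  have := isFiniteMeasure_withDensity_ofReal hf1.2
  have := isFiniteMeasure_withDensity_symmDecrRearrangement hn hf0.measurable_mk hf1
  rw [symmDecrRearrangement_congr_ae hf0.ae_eq_mk,
    withDensity_congr_ae (hf0.ae_eq_mk.mono fun y hy => congrArg ENNReal.ofReal hy),
    hlayers, hlayers]
  refine lintegral_antitone_norm_le_of_forall_ball_le (withDensity_absolutelyContinuous _ _)
    (withDensity_absolutelyContinuous _ _) (fun R => ?_) hφ
  rw [withDensity_apply _ measurableSet_ball, withDensity_apply _ measurableSet_ball]
  exact setLIntegral_ball_pi_le_symmDecrRearrangement hn hC hCc hf0.measurable_mk hf1 R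

theorem HasIIDColumns.lintegral_comp {Ω : Type*} [MeasurableSpace Ω] {P : Measure Ω}
    {X : Fin m → Ω → EuclideanSpace ℝ (Fin n)} {g : EuclideanSpace ℝ (Fin n) → ℝ≥0∞}
    [IsProbabilityMeasure P]
    (hX : HasIIDColumns P X g) {F : (Fin m → EuclideanSpace ℝ (Fin n)) → ℝ≥0∞}
    (hF : Measurable F) :
    ∫⁻ ω, F (fun j => X j ω) ∂P =
      ∫⁻ x, F x ∂Measure.pi fun _ : Fin m => volume.withDensity g := by
  rw [← lintegral_map hF (measurable_pi_lambda _ hX.measurable),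
    hX.indep.map_fun_eq_pi_map fun j => (hX.measurable j).aemeasurable]
  simp only [hX.law]

theorem lintegral_measure_polarProjectionBody_matrixImage_le (hn : 1 ≤ n) (hC : IsCompact C)
    (hCc : Convex ℝ C) {f : EuclideanSpace ℝ (Fin n) → ℝ} (hf : Integrable f)
    {Ω Ω' : Type*} [MeasurableSpace Ω] [MeasurableSpace Ω'] {P : Measure Ω} {P' : Measure Ω'}
    [IsProbabilityMeasure P] [IsProbabilityMeasure P']
    {X : Fin m → Ω → EuclideanSpace ℝ (Fin n)} {X' : Fin m → Ω' → EuclideanSpace ℝ (Fin n)}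
    (hX : HasIIDColumns P X fun x => ENNReal.ofReal (f x))
    (hX' : HasIIDColumns P' X' (symmDecrRearrangement f))
    {ν : Measure (EuclideanSpace ℝ (Fin n))} (hν : IsRadialDecreasing ν) :
    ∫⁻ ω, ν (polarProjectionBody (matrixImage (fun j => X j ω) C)) ∂P ≤
      ∫⁻ ω, ν (polarProjectionBody (matrixImage (fun j => X' j ω) C)) ∂P' := by
  have hνs : SFinite ν := by
    obtain ⟨ρ, -, -, rfl⟩ := hν
    infer_instance
  have hm := measurable_measure_polarProjectionBody hC hCc ν
  rw [hX.lintegral_comp hm, hX'.lintegral_comp hm]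
  exact lintegral_pi_measure_polarProjectionBody_le hn hC hCc hf hν

end RandomColumns

section RandomPolytopes

variable {n m : ℕ}

theorem IsUniformSample.hasIIDColumns {Ω : Type*} [MeasurableSpace Ω] {P : Measure Ω}
    {Y : Fin m → Ω → EuclideanSpace ℝ (Fin n)} {K : Set (EuclideanSpace ℝ (Fin n))}
    (hY : IsUniformSample P Y K) (hK : MeasurableSet K) :
    HasIIDColumns P Y (K.indicator fun _ => (volume K)⁻¹) where
  measurable := hY.measurable
  indep := hY.indep
  law j := (hY.uniform j).trans <| by
    rw [withDensity_indicator hK, withDensity_const, ProbabilityTheory.cond]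

/-- The standard simplex, as a subset of Euclidean space; its image under the matrix with columns
`x₁, …, x_m` is the convex hull of the columns. -/
def euclideanSimplex (m : ℕ) : Set (EuclideanSpace ℝ (Fin m)) :=
  WithLp.toLp 2 '' stdSimplex ℝ (Fin m)

theorem isCompact_euclideanSimplex (m : ℕ) : IsCompact (euclideanSimplex m) :=
  (isCompact_stdSimplex ℝ (Fin m)).image (PiLp.continuous_toLp 2 _)

theorem convex_euclideanSimplex (m : ℕ) : Convex ℝ (euclideanSimplex m) :=
  (convex_stdSimplex ℝ (Fin m)).is_linear_image (WithLp.linearEquiv 2 ℝ _).symm.isLinear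

theorem matrixImage_euclideanSimplex (x : Fin m → EuclideanSpace ℝ (Fin n)) :
    matrixImage x (euclideanSimplex m) = convexHull ℝ (range x) := by
  rw [matrixImage, euclideanSimplex, image_image, ← convexHull_basis_eq_stdSimplex]
  refine ((Fintype.linearCombination ℝ x).image_convexHull _).trans ?_
  rw [← range_comp]
  congr 2
  ext1 i
  simp [Fintype.linearCombination_apply]

theorem measurable_measure_polarProjectionBody_convexHull
    (ν : Measure (EuclideanSpace ℝ (Fin n))) [SFinite ν] :
    Measurable fun x : Fin m → EuclideanSpace ℝ (Fin n) =>
      ν (polarProjectionBody (convexHull ℝ (range x))) := by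
  simp only [← matrixImage_euclideanSimplex]
  exact measurable_measure_polarProjectionBody (isCompact_euclideanSimplex m)
    (convex_euclideanSimplex m) ν

theorem measurableSet_polarProjectionBody_convexHull (x : Fin m → EuclideanSpace ℝ (Fin n)) :
    MeasurableSet (polarProjectionBody (convexHull ℝ (range x))) := by
  rw [← matrixImage_euclideanSimplex]
  exact measurableSet_polarProjectionBody_matrixImage (isCompact_euclideanSimplex m)
    (convex_euclideanSimplex m) x

theorem lintegral_measure_polarProjectionBody_convexHull_le (hn : 1 ≤ n)
    {K : Set (EuclideanSpace ℝ (Fin n))} (hK : MeasurableSet K) (hK0 : volume K ≠ 0)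
    (hKt : volume K ≠ ∞)
    {Ω Ω' : Type*} [MeasurableSpace Ω] [MeasurableSpace Ω'] {P : Measure Ω} {P' : Measure Ω'}
    [IsProbabilityMeasure P] [IsProbabilityMeasure P']
    {Y : Fin m → Ω → EuclideanSpace ℝ (Fin n)} {Y' : Fin m → Ω' → EuclideanSpace ℝ (Fin n)}
    (hY : IsUniformSample P Y K) (hY' : IsUniformSample P' Y' (symmRearrangement K))
    {ν : Measure (EuclideanSpace ℝ (Fin n))} (hν : IsRadialDecreasing ν) :
    ∫⁻ ω, ν (polarProjectionBody (convexHull ℝ (range fun j => Y j ω))) ∂P ≤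
      ∫⁻ ω, ν (polarProjectionBody (convexHull ℝ (range fun j => Y' j ω))) ∂P' := by
  have hvol : ENNReal.ofReal (volume K)⁻¹.toReal = (volume K)⁻¹ :=
    ENNReal.ofReal_toReal (ENNReal.inv_ne_top.2 hK0)
  have hX := hY.hasIIDColumns hK
  have hX' := hY'.hasIIDColumns measurableSet_ball
  rw [volume_symmRearrangement hn K hKt] at hX'
  simp only [← matrixImage_euclideanSimplex]
  refine lintegral_measure_polarProjectionBody_matrixImage_le hn (isCompact_euclideanSimplex m)
    (convex_euclideanSimplex m) (f := K.indicator fun _ => (volume K)⁻¹.toReal)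
    ((integrable_indicator_iff hK).2 (integrableOn_const hKt)) ?_ ?_ hν
  · convert! hX using 1
    ext x
    by_cases hx : x ∈ K <;> simp only [hx, indicator_of_mem, indicator_of_notMem, hvol,
      ENNReal.ofReal_zero, not_false_eq_true]
  · rwa [symmDecrRearrangement_indicator hn, hvol]

theorem isRadialDecreasing_volume :
    IsRadialDecreasing (volume : Measure (EuclideanSpace ℝ (Fin n))) :=
  ⟨fun _ => 1, fun _ _ _ _ _ => le_rfl, fun _ _ => zero_le_one, by simp⟩

theorem IsConvexBody.volume_ne_zero {K : Set (EuclideanSpace ℝ (Fin n))}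
    (hK : IsConvexBody K) : volume K ≠ 0 :=
  (Measure.measure_pos_of_nonempty_interior _ hK.interior_nonempty).ne'

end RandomPolytopes

section Monotonicity

variable {n : ℕ}

theorem polarProjectionBody_anti {K K' : Set (EuclideanSpace ℝ (Fin n))} (h : K ⊆ K') :
    polarProjectionBody K' ⊆ polarProjectionBody K :=
  fun _ hx => (mul_le_mul_right (measure_mono (image_mono h)) _).trans hx

theorem iInter_polarProjectionBody_subset {S : ℕ → Set (EuclideanSpace ℝ (Fin n))}
    (hS : Monotone S) : ⋂ k, polarProjectionBody (S k) ⊆ polarProjectionBody (⋃ k, S k) := by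
  intro x hx
  have hproj : Monotone fun k => (Submodule.span ℝ {x})ᗮ.orthogonalProjectionOnto '' S k :=
    fun a b hab => image_mono (hS hab)
  rw [polarProjectionBody, mem_ofPred_eq, projectionBodySupport, image_iUnion,
    hproj.measure_iUnion, ENNReal.mul_iSup]
  exact iSup_le (mem_iInter.1 hx)

end Monotonicity

section DenseSequences

variable {E : Type*}

theorem subset_convexHull_of_isOpen_of_subset_closure [NormedAddCommGroup E] [NormedSpace ℝ E]
    [FiniteDimensional ℝ E] {B S : Set E} (hB : IsOpen B) (h : B ⊆ closure S) :
    B ⊆ convexHull ℝ S := by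
  rcases B.eq_empty_or_nonempty with rfl | hne
  · exact empty_subset _
  have hT : Convex ℝ (convexHull ℝ S) := convex_convexHull ℝ S
  have hspan : affineSpan ℝ (convexHull ℝ S) = ⊤ := by
    rw [affineSpan_convexHull, ← top_le_iff, ← hB.affineSpan_eq_top hne, affineSpan_le]
    exact h.trans (closure_minimal (subset_affineSpan ℝ S)
      (AffineSubspace.closed_of_finiteDimensional _))
  calc B ⊆ interior (closure (convexHull ℝ S)) :=
        interior_maximal (h.trans (closure_mono (subset_convexHull ℝ S))) hB
    _ = interior (convexHull ℝ S) := hT.interior_closure_eq_interior_of_nonempty_interior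
        (hT.interior_nonempty_iff_affineSpan_eq_top.2 hspan)
    _ ⊆ convexHull ℝ S := interior_subset

theorem monotone_convexHull_range_fin [AddCommGroup E] [Module ℝ E] (ω : ℕ → E) :
    Monotone fun k : ℕ => convexHull ℝ (range fun j : Fin k => ω j) := by
  refine fun a b hab => convexHull_mono ?_
  rintro _ ⟨j, rfl⟩
  exact ⟨Fin.castLE hab j, rfl⟩

theorem convexHull_range_subset_iUnion [AddCommGroup E] [Module ℝ E] (ω : ℕ → E) :
    convexHull ℝ (range ω) ⊆ ⋃ k : ℕ, convexHull ℝ (range fun j : Fin k => ω j) := by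
  refine convexHull_min ?_ (Directed.convex_iUnion
    (monotone_convexHull_range_fin ω).directed_le fun k => convex_convexHull ℝ _)
  rintro _ ⟨j, rfl⟩
  exact mem_iUnion.2 ⟨j + 1, subset_convexHull ℝ _ ⟨Fin.last j, rfl⟩⟩

theorem iInter_polarProjectionBody_convexHull_subset {n : ℕ}
    {B : Set (EuclideanSpace ℝ (Fin n))} (hB : IsOpen B) {ω : ℕ → EuclideanSpace ℝ (Fin n)}
    (hω : B ⊆ closure (range ω)) :
    ⋂ k : ℕ, polarProjectionBody (convexHull ℝ (range fun j : Fin k => ω j)) ⊆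
      polarProjectionBody B :=
  (iInter_polarProjectionBody_subset (monotone_convexHull_range_fin ω)).trans
    (polarProjectionBody_anti ((subset_convexHull_of_isOpen_of_subset_closure hB hω).trans
      (convexHull_range_subset_iUnion ω)))

theorem ae_infinitePi_exists_mem [MeasurableSpace E] (μ : Measure E) [IsProbabilityMeasure μ]
    {U : Set E} (hU : MeasurableSet U) (h : μ U ≠ 0) :
    ∀ᵐ ω ∂Measure.infinitePi fun _ : ℕ => μ, ∃ j, ω j ∈ U := by
  have hlt : μ Uᶜ < 1 := by
    rw [prob_compl_eq_one_sub hU]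
    exact ENNReal.sub_lt_self ENNReal.one_ne_top one_ne_zero h
  refine le_antisymm (ge_of_tendsto' (ENNReal.tendsto_pow_atTop_nhds_zero_of_lt_one hlt)
    fun k => ?_) zero_le
  calc _ ≤ Measure.infinitePi (fun _ : ℕ => μ) (Set.pi (Finset.range k) fun _ => Uᶜ) :=
        measure_mono fun ω (hω : ¬∃ j, ω j ∈ U) j _ hj => hω ⟨j, hj⟩
    _ = μ Uᶜ ^ k := by
        rw [Measure.infinitePi_pi _ fun _ _ => hU.compl, Finset.prod_const, Finset.card_range]

theorem ae_infinitePi_subset_closure_range [TopologicalSpace E] [SecondCountableTopology E]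
    [MeasurableSpace E] [OpensMeasurableSpace E] (μ : Measure E) [IsProbabilityMeasure μ]
    {B : Set E} (hB : ∀ U, IsOpen U → (U ∩ B).Nonempty → μ U ≠ 0) :
    ∀ᵐ ω ∂Measure.infinitePi fun _ : ℕ => μ, B ⊆ closure (range ω) := by
  have hbasis := TopologicalSpace.isBasis_countableBasis E
  have hmeets : ∀ᵐ ω ∂Measure.infinitePi fun _ : ℕ => μ,
      ∀ U ∈ TopologicalSpace.countableBasis E, (U ∩ B).Nonempty → ∃ j, ω j ∈ U := by
    refine (ae_ball_iff (TopologicalSpace.countable_countableBasis E)).2 fun U hU => ?_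
    by_cases hne : (U ∩ B).Nonempty
    · have hUo := hbasis.isOpen hU
      exact (ae_infinitePi_exists_mem μ hUo.measurableSet (hB U hUo hne)).mono fun _ h _ => h
    · exact .of_forall fun _ h => absurd h hne
  filter_upwards [hmeets] with ω hω x hx
  refine hbasis.mem_closure_iff.2 fun U hU hxU => ?_
  obtain ⟨j, hj⟩ := hω U hU ⟨x, hxU, hx⟩
  exact ⟨ω j, hj, mem_range_self j⟩

end DenseSequences

section Petty

variable {n m : ℕ}

theorem IsUniformSample.ae_mem {Ω : Type*} [MeasurableSpace Ω] {P : Measure Ω}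
    {Y : Fin m → Ω → EuclideanSpace ℝ (Fin n)} {K : Set (EuclideanSpace ℝ (Fin n))}
    (hY : IsUniformSample P Y K) (hK : MeasurableSet K) : ∀ᵐ ω ∂P, ∀ j, Y j ω ∈ K :=
  ae_all_iff.2 fun j => ae_of_ae_map (hY.measurable j).aemeasurable <| by
    rw [hY.uniform j]
    exact ae_cond_mem hK

theorem isUniformSample_infinitePi (m : ℕ) (K : Set (EuclideanSpace ℝ (Fin n)))
    [IsProbabilityMeasure (ProbabilityTheory.cond volume K)] :
    IsUniformSample (Measure.infinitePi fun _ : ℕ => ProbabilityTheory.cond volume K)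
      (fun (j : Fin m) ω => ω j) K where
  measurable _ := measurable_pi_apply _
  indep := (iIndepFun_infinitePi (X := fun _ y => y) fun _ => measurable_id).precomp
    Fin.val_injective
  uniform j := Measure.infinitePi_map_eval _ (j : ℕ)

theorem measure_polarProjectionBody_le_lintegral {Ω : Type*} [MeasurableSpace Ω] {P : Measure Ω}
    [IsProbabilityMeasure P] {Y : Fin m → Ω → EuclideanSpace ℝ (Fin n)}
    {K : Set (EuclideanSpace ℝ (Fin n))} (hK : Convex ℝ K) (hY : ∀ᵐ ω ∂P, ∀ j, Y j ω ∈ K)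
    (ν : Measure (EuclideanSpace ℝ (Fin n))) :
    ν (polarProjectionBody K) ≤
      ∫⁻ ω, ν (polarProjectionBody (convexHull ℝ (range fun j => Y j ω))) ∂P :=
  calc ν (polarProjectionBody K) = ∫⁻ _, ν (polarProjectionBody K) ∂P := by simp
    _ ≤ _ := lintegral_mono_ae (hY.mono fun _ hω => measure_mono
      (polarProjectionBody_anti (convexHull_min (range_subset_iff.2 hω) hK)))

theorem tendsto_lintegral_measure_polarProjectionBody_convexHull
    (ν : Measure (EuclideanSpace ℝ (Fin n))) [IsFiniteMeasure ν]
    (P : Measure (ℕ → EuclideanSpace ℝ (Fin n))) [IsFiniteMeasure P] :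
    Filter.Tendsto (fun k : ℕ =>
        ∫⁻ ω, ν (polarProjectionBody (convexHull ℝ (range fun j : Fin k => ω j))) ∂P)
      Filter.atTop (nhds (∫⁻ ω,
        ν (⋂ k : ℕ, polarProjectionBody (convexHull ℝ (range fun j : Fin k => ω j))) ∂P)) := by
  refine tendsto_lintegral_of_dominated_convergence (fun _ => ν univ)
    (fun k => (measurable_measure_polarProjectionBody_convexHull ν).comp
      (measurable_pi_lambda _ fun j => measurable_pi_apply _))
    (fun k => .of_forall fun ω => measure_mono (subset_univ _)) ?_ (.of_forall fun ω => ?_)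
  · rw [lintegral_const]
    finiteness
  · exact tendsto_measure_iInter_atTop
      (fun k => (measurableSet_polarProjectionBody_convexHull _).nullMeasurableSet)
      (fun a b hab => polarProjectionBody_anti (monotone_convexHull_range_fin ω hab))
      ⟨0, measure_ne_top _ _⟩

theorem lintegral_measure_iInter_polarProjectionBody_le {B : Set (EuclideanSpace ℝ (Fin n))}
    (hB : IsOpen B) (hBt : volume B ≠ ∞) [IsProbabilityMeasure (ProbabilityTheory.cond volume B)]
    (ν : Measure (EuclideanSpace ℝ (Fin n))) :
    ∫⁻ ω, ν (⋂ k : ℕ, polarProjectionBody (convexHull ℝ (range fun j : Fin k => ω j)))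
        ∂Measure.infinitePi (fun _ : ℕ => ProbabilityTheory.cond volume B) ≤
      ν (polarProjectionBody B) := by
  have hdense := ae_infinitePi_subset_closure_range (ProbabilityTheory.cond volume B) (B := B)
    fun U hU hne => by
      rw [cond_apply hB.measurableSet, inter_comm]
      exact mul_ne_zero (ENNReal.inv_ne_zero.2 hBt) ((hU.inter hB).measure_pos _ hne).ne'
  calc _ ≤ ∫⁻ _, ν (polarProjectionBody B)
        ∂Measure.infinitePi (fun _ : ℕ => ProbabilityTheory.cond volume B) :=
        lintegral_mono_ae (hdense.mono fun _ hω =>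
          measure_mono (iInter_polarProjectionBody_convexHull_subset hB hω))
    _ = _ := by simp

theorem measure_polarProjectionBody_le_of_isFiniteMeasure (hn : 1 ≤ n)
    {K : Set (EuclideanSpace ℝ (Fin n))} (hK : Convex ℝ K) (hKm : MeasurableSet K)
    (hK0 : volume K ≠ 0) (hKt : volume K ≠ ∞)
    {ν : Measure (EuclideanSpace ℝ (Fin n))} [IsFiniteMeasure ν] (hν : IsRadialDecreasing ν) :
    ν (polarProjectionBody K) ≤ ν (polarProjectionBody (symmRearrangement K)) := by
  have hvol := volume_symmRearrangement hn K hKt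
  have := cond_isProbabilityMeasure_of_finite hK0 hKt
  have := cond_isProbabilityMeasure_of_finite (hvol.trans_ne hK0) (hvol.trans_ne hKt)
  refine (ge_of_tendsto' (tendsto_lintegral_measure_polarProjectionBody_convexHull ν
    (Measure.infinitePi fun _ => ProbabilityTheory.cond volume (symmRearrangement K)))
    fun k => ?_).trans (lintegral_measure_iInter_polarProjectionBody_le
      (B := symmRearrangement K) Metric.isOpen_ball (hvol.trans_ne hKt) ν)
  have hY := isUniformSample_infinitePi k K
  exact (measure_polarProjectionBody_le_lintegral hK (hY.ae_mem hKm) ν).trans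
    (lintegral_measure_polarProjectionBody_convexHull_le hn hKm hK0 hKt hY
      (isUniformSample_infinitePi k _) hν)

theorem isRadialDecreasing_restrict_ball (R : ℝ) : IsRadialDecreasing
    ((volume : Measure (EuclideanSpace ℝ (Fin n))).restrict (Metric.ball 0 R)) := by
  refine ⟨(Iio R).indicator 1, fun a _ b _ hab => ?_, fun r _ => ?_, ?_⟩
  · by_cases hb : b < R
    · simp [hb, hab.trans_lt hb]
    · rw [indicator_of_notMem (notMem_Iio.2 (not_lt.1 hb))]
      exact indicator_nonneg (fun _ _ => zero_le_one) a
  · exact indicator_nonneg (fun _ _ => zero_le_one) r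
  · rw [← withDensity_indicator_one measurableSet_ball]
    congr 1
    ext x
    by_cases hx : ‖x‖ < R <;> simp [hx]

theorem measure_polarProjectionBody_le (hn : 1 ≤ n) {K : Set (EuclideanSpace ℝ (Fin n))}
    (hK : Convex ℝ K) (hKm : MeasurableSet K) (hK0 : volume K ≠ 0) (hKt : volume K ≠ ∞)
    {ν : Measure (EuclideanSpace ℝ (Fin n))} (hν : IsRadialDecreasing ν) :
    ν (polarProjectionBody K) ≤ ν (polarProjectionBody (symmRearrangement K)) := by
  have : Nonempty (Fin n) := ⟨⟨0, hn⟩⟩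
  obtain ⟨φ, hφ, rfl⟩ := hν.exists_antitone hn
  rw [withDensity_apply', withDensity_apply']
  refine lintegral_antitone_norm_le_of_forall_ball_le Measure.absolutelyContinuous_restrict
    Measure.absolutelyContinuous_restrict (fun R => ?_) hφ
  have := isFiniteMeasure_restrict.2
    (measure_ball_lt_top (μ := volume) (x := (0 : EuclideanSpace ℝ (Fin n))) (r := R)).ne
  have hball := measure_polarProjectionBody_le_of_isFiniteMeasure hn hK hKm hK0 hKt
    (isRadialDecreasing_restrict_ball R)
  rwa [Measure.restrict_apply' measurableSet_ball, Measure.restrict_apply' measurableSet_ball,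
    inter_comm, inter_comm _ (Metric.ball 0 R), ← Measure.restrict_apply measurableSet_ball,
    ← Measure.restrict_apply measurableSet_ball] at hball

end Petty

theorem theorem1p2_general (n : ℕ) (hn : 1 ≤ n) :
    (∀ (m : ℕ) (C : Set (EuclideanSpace ℝ (Fin m))), IsCompact C → Convex ℝ C →
      ∀ f : EuclideanSpace ℝ (Fin n) → ℝ, Integrable f →
      ∀ (Ω Ω' : Type*) [MeasurableSpace Ω] [MeasurableSpace Ω']
        (P : Measure Ω) (P' : Measure Ω') [IsProbabilityMeasure P] [IsProbabilityMeasure P']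
        (X : Fin m → Ω → EuclideanSpace ℝ (Fin n)) (X' : Fin m → Ω' → EuclideanSpace ℝ (Fin n)),
        HasIIDColumns P X (fun x => ENNReal.ofReal (f x)) →
        HasIIDColumns P' X' (symmDecrRearrangement f) →
      ∀ ν : Measure (EuclideanSpace ℝ (Fin n)), IsRadialDecreasing ν →
        ∫⁻ ω, ν (polarProjectionBody (matrixImage (fun j => X j ω) C)) ∂P ≤
          ∫⁻ ω, ν (polarProjectionBody (matrixImage (fun j => X' j ω) C)) ∂P') ∧
    (∀ (m : ℕ) (K : Set (EuclideanSpace ℝ (Fin n))),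
      MeasurableSet K → volume K ≠ 0 → volume K ≠ ∞ →
      ∀ (Ω Ω' : Type*) [MeasurableSpace Ω] [MeasurableSpace Ω']
        (P : Measure Ω) (P' : Measure Ω') [IsProbabilityMeasure P] [IsProbabilityMeasure P']
        (Y : Fin m → Ω → EuclideanSpace ℝ (Fin n)) (Y' : Fin m → Ω' → EuclideanSpace ℝ (Fin n)),
        IsUniformSample P Y K →
        IsUniformSample P' Y' (symmRearrangement K) →
      ∀ ν : Measure (EuclideanSpace ℝ (Fin n)), IsRadialDecreasing ν →
        ∫⁻ ω, ν (polarProjectionBody (convexHull ℝ (range fun j => Y j ω))) ∂P ≤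
          ∫⁻ ω, ν (polarProjectionBody (convexHull ℝ (range fun j => Y' j ω))) ∂P') ∧
    (∀ K : Set (EuclideanSpace ℝ (Fin n)), Convex ℝ K →
      MeasurableSet K → volume K ≠ 0 → volume K ≠ ∞ →
      ∀ ν : Measure (EuclideanSpace ℝ (Fin n)), IsRadialDecreasing ν →
        ν (polarProjectionBody K) ≤ ν (polarProjectionBody (symmRearrangement K))) :=
  ⟨fun _ _ hC hCc _ hf _ _ _ _ _ _ _ _ _ _ hX hX' _ hν =>
      lintegral_measure_polarProjectionBody_matrixImage_le hn hC hCc hf hX hX' hν,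
    fun _ _ hK hK0 hKt _ _ _ _ _ _ _ _ _ _ hY hY' _ hν =>
      lintegral_measure_polarProjectionBody_convexHull_le hn hK hK0 hKt hY hY' hν,
    fun _ hK hKm hK0 hKt _ hν => measure_polarProjectionBody_le hn hK hKm hK0 hKt hν⟩

theorem theorem1p2 (n : ℕ) (hn : 1 ≤ n) :
    -- the inequality for random linear images of a compact convex set
    (∀ (m : ℕ) (C : Set (EuclideanSpace ℝ (Fin m))), IsCompact C → Convex ℝ C →
      ∀ f : EuclideanSpace ℝ (Fin n) → ℝ, IsProbDensity f →
      ∀ (Ω Ω' : Type*) [MeasurableSpace Ω] [MeasurableSpace Ω']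
        (P : Measure Ω) (P' : Measure Ω') [IsProbabilityMeasure P] [IsProbabilityMeasure P']
        (X : Fin m → Ω → EuclideanSpace ℝ (Fin n)) (X' : Fin m → Ω' → EuclideanSpace ℝ (Fin n)),
        HasIIDColumns P X (fun x => ENNReal.ofReal (f x)) →
        HasIIDColumns P' X' (symmDecrRearrangement f) →
      ∀ ν : Measure (EuclideanSpace ℝ (Fin n)), IsRadialDecreasing ν →
        ∫⁻ ω, ν (polarProjectionBody (matrixImage (fun j => X j ω) C)) ∂P ≤
          ∫⁻ ω, ν (polarProjectionBody (matrixImage (fun j => X' j ω) C)) ∂P') ∧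
    -- the special case of random polytopes
    (∀ (m : ℕ) (K : Set (EuclideanSpace ℝ (Fin n))), IsConvexBody K →
      ∀ (Ω Ω' : Type*) [MeasurableSpace Ω] [MeasurableSpace Ω']
        (P : Measure Ω) (P' : Measure Ω') [IsProbabilityMeasure P] [IsProbabilityMeasure P']
        (Y : Fin m → Ω → EuclideanSpace ℝ (Fin n)) (Y' : Fin m → Ω' → EuclideanSpace ℝ (Fin n)),
        IsUniformSample P Y K →
        IsUniformSample P' Y' (symmRearrangement K) →
        ∫⁻ ω, volume (polarProjectionBody (convexHull ℝ (range fun j => Y j ω))) ∂P ≤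
          ∫⁻ ω, volume (polarProjectionBody (convexHull ℝ (range fun j => Y' j ω))) ∂P') ∧
    -- Petty's projection inequality
    (∀ K : Set (EuclideanSpace ℝ (Fin n)), IsConvexBody K →
      volume (polarProjectionBody K) ≤ volume (polarProjectionBody (symmRearrangement K))) := by
  obtain ⟨hmatrix, hhull, hpetty⟩ := theorem1p2_general n hn
  exact ⟨fun m C hC hCc f hf => hmatrix m C hC hCc f hf.integrable,
    fun m K hK Ω Ω' _ _ P P' _ _ Y Y' hY hY' => hhull m K hK.compact.measurableSet
      hK.volume_ne_zero hK.compact.measure_ne_top Ω Ω' P P' Y Y' hY hY' _ isRadialDecreasing_volume,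
    fun K hK => hpetty K hK.convex hK.compact.measurableSet hK.volume_ne_zero
      hK.compact.measure_ne_top _ isRadialDecreasing_volume⟩
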